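/- Let $I=[a,b]\subset\mathbb{R}$ be a compact interval and let $f\colon I\to I$ be a unimodal map with turning point $c$; that is, $f$ is continuous, $a<c<b$, and $f$ is strictly monotone on $[a,c]$ and on $[c,b]$, increasing on one of these intervals and decreasing on the other. A point $x\in I$ is periodic if $f^n(x)=x$ for some $n\ge 1$, and the least such $n$ is its minimal period. A periodic point $x$ of minimal period $n$ is repelling if there is an open neighbourhood $U$ of $x$ in $I$ such that for every $y\in U\setminus\{x\}$ there is $k\in\mathbb{N}$ with $f^{nk}(y)\notin U$. A point $y\in I$ is asymptotic to a periodic orbit if there are a periodic point $x$, of minimal period $n$, and $m\in\mathbb{N}$ with $\lim_{k\to\infty}f^{kn+m}(y)=x$. Suppose that all but finitely many of the periodic points of $f$ are repelling. Then $f^n$ has only finitely many fixed points for every $n\ge 1$, so the Artin–Mazur zeta function $$\zeta_f(t)=\exp\Bigl(\sum_{n\ge 1}\frac{N_n(f)}{n}\,t^n\Bigr)\in\mathbb{Q}[[t]],$$ where $N_n(f)$ is the number of isolated fixed points of $f^n$, is well defined; and $\zeta_f$ is a rational function, i.e. $Q\,\zeta_f=P$ for some polynomials $P,Q\in\mathbb{Q}[t]$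 with $Q\neq 0$, if and only if the turning point $c$ is asymptotic to a periodic orbit of $f$. -/

import Mathlib

namespace IntervalZeta

open Filter Topology

section Dynamics

variable {X : Type*} [TopologicalSpace X]

/-- The periodic point `x`, of minimal period `n`, is repelling: it has an open neighbourhood `U`
such that every `y ∈ U` other than `x` is eventually moved out of `U` by an iterate of `f^n`. -/
def IsRepelling (f : X → X) (x : X) : Prop :=
  x ∈ Function.periodicPts f ∧
    ∃ U : Set X, IsOpen U ∧ x ∈ U ∧
      ∀ y ∈ U, y ≠ x → ∃ k : ℕ, f^[Function.minimalPeriod f x * k] y ∉ U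

/-- The point `y` is asymptotic to some periodic orbit of `f`: there are a periodic point `x`, of
minimal period `n`, and `m ∈ ℕ` such that `f^(k n + m) (y) → x` as `k → ∞`. -/
def IsAsymptoticToPeriodicOrbit (f : X → X) (y : X) : Prop :=
  ∃ x ∈ Function.periodicPts f, ∃ m : ℕ,
    Tendsto (fun k : ℕ => f^[k * Function.minimalPeriod f x + m] y) atTop (𝓝 x)

/-- The set of isolated fixed points of `f^n`, i.e. isolated points of the set of its fixed
points. -/
def isolatedFixedPts (f : X → X) (n : ℕ) : Set X :=
  {x | x ∈ Function.fixedPoints f^[n] ∧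
    ∃ U : Set X, IsOpen U ∧ x ∈ U ∧ ∀ y ∈ U, y ∈ Function.fixedPoints f^[n] → y = x}

/-- The formal power series `∑_{n ≥ 1} (N_n(f) / n) t^n`, where `N_n(f)` is the number of isolated
fixed points of `f^n`. -/
noncomputable def logZeta (f : X → X) : PowerSeries ℚ :=
  PowerSeries.mk fun n => if n = 0 then 0 else ((isolatedFixedPts f n).ncard : ℚ) / n

/-- `logZeta f` has zero constant term, so it may be substituted into any formal power series. -/
theorem hasSubst_logZeta (f : X → X) : PowerSeries.HasSubst (logZeta f) :=
  PowerSeries.HasSubst.of_constantCoeff_zero' (by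
    rw [← PowerSeries.coeff_zero_eq_constantCoeff_apply]; simp [logZeta])

/-- The Artin–Mazur zeta function of `f`: the formal power series
`exp (∑_{n ≥ 1} (N_n(f) / n) t^n)`. It is the intended object when every `f^n`, `n ≥ 1`, has only
finitely many fixed points. -/
noncomputable def artinMazurZeta (f : X → X) : PowerSeries ℚ :=
  (PowerSeries.exp ℚ).subst (logZeta f)

end Dynamics

/-- A formal power series is (the expansion of) a rational function `P / Q`. -/
def IsRationalSeries (F : PowerSeries ℚ) : Prop :=
  ∃ P Q : Polynomial ℚ, Q ≠ 0 ∧ (Q : PowerSeries ℚ) * F = (P : PowerSeries ℚ)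

/-- `f : [a, b] → [a, b]` is unimodal with turning point `c`: it is continuous, `a < c < b`, and `f`
is strictly monotone on `[a, c]` and on `[c, b]`, in opposite directions. -/
structure IsUnimodal {a b : ℝ} (f : Set.Icc a b → Set.Icc a b) (c : Set.Icc a b) : Prop where
  continuous : Continuous f
  left_lt : a < (c : ℝ)
  lt_right : (c : ℝ) < b
  monotone_pieces :
    (StrictMonoOn f (Set.Iic c) ∧ StrictAntiOn f (Set.Ici c)) ∨
      (StrictAntiOn f (Set.Iic c) ∧ StrictMonoOn f (Set.Ici c))

end IntervalZeta

/-!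
A germ is a point together with a side from which it is approached. A map `f` that is strictly
monotone on either side of `c` acts on germs, and the direction of `f^n` along a germ is a step
function of the germ, which jumps exactly at the points `u` with `f^i u = c` for some `i < n`. For
the first such `i` the jump at `u` is `-2` times the direction of `f^(n-i)` at the left germ of `c`.
Let `D` be the generating series of the latter directions, which are signs `±1` and amount to the
kneading sequence of `f`. A step function is the sum of its jumps, and this gives two identities
that involve `D` and the numbers of preimages of `c` to the left of the germs on the orbit of `c`:
one from the directions of `f^n` along these germs, and one, which contains the number of fixed
points of `f^n`, from the function that is the direction of `f^n` where `f^n` moves points to the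
right and `0` elsewhere. The latter jumps also at the fixed points, by an amount that counts the
adjacent germs which `f^n` fixes and attracts.

Eliminating the preimage counts shows that `t ζ'/ζ + t D'/D` is the generating series of the numbers
of points fixed by the iterates of two maps: that on attracting germs and that on the orbit of `c`
if it is a periodic orbit. Only finitely many germs are attracting since almost all periodic points
are repelling. The series of a permutation of a finite set is `-t Z'/Z` for a polynomial `Z`, so
`ζ D Z` is a nonzero constant, and `ζ` is rational if and only if `D` is.

A power series with finitely many distinct coefficients is rational if and only if they are
eventually periodic. If the kneading sequence has this property, with period `p`, then for large `m`
the points `f^(m + k p) c` move in a constant direction, so they converge to a periodic point.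
Conversely, if `c` is asymptotic to a periodic orbit which avoids `c`, then its itinerary is
eventually that of this orbit.
-/

namespace IntervalZeta

open Filter Topology

/-! ### Germs -/

section Germs

/-- A germ: the point `g.1` approached from the side `g.2`, which is the right side if `g.2 = 1` and
the left side if `g.2 = -1`. -/
abbrev Germ (X : Type*) := X × ℤˣ

variable {X : Type*}

/-- `DirLT σ x y` says that `y` lies on the side `σ` of `x`: to its right if `σ = 1`, to its left if
`σ = -1`. -/
def DirLT [LT X] (σ : ℤˣ) (x y : X) : Prop := if σ = 1 then x < y else y < x

theorem dirLT_one [LT X] {x y : X} : DirLT 1 x y ↔ x < y := by simp [DirLT]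

theorem dirLT_neg_one [LT X] {x y : X} : DirLT (-1) x y ↔ y < x := by
  simp [DirLT, show (-1 : ℤˣ) ≠ 1 by decide]

theorem dirLT_neg [LT X] {σ : ℤˣ} {x y : X} : DirLT (-σ) x y ↔ DirLT σ y x := by
  rcases Int.units_eq_one_or σ with rfl | rfl
  · rw [dirLT_neg_one, dirLT_one]
  · rw [neg_neg, dirLT_neg_one, dirLT_one]

theorem DirLT.trans [Preorder X] {σ : ℤˣ} {x y z : X} (hxy : DirLT σ x y) (hyz : DirLT σ y z) :
    DirLT σ x z := by
  rcases Int.units_eq_one_or σ with rfl | rfl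
  · rw [dirLT_one] at *; exact hxy.trans hyz
  · rw [dirLT_neg_one] at *; exact hyz.trans hxy

theorem DirLT.asymm [Preorder X] {σ : ℤˣ} {x y : X} (h : DirLT σ x y) : ¬ DirLT σ y x := by
  rcases Int.units_eq_one_or σ with rfl | rfl
  · rw [dirLT_one] at *; exact h.asymm
  · rw [dirLT_neg_one] at *; exact h.asymm

theorem DirLT.ne [Preorder X] {σ : ℤˣ} {x y : X} (h : DirLT σ x y) : x ≠ y := by
  rintro rfl; exact h.asymm h

variable [LinearOrder X]

theorem dirLT_or_dirLT (σ : ℤˣ) {x y : X} (h : x ≠ y) : DirLT σ x y ∨ DirLT σ y x := by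
  rcases Int.units_eq_one_or σ with rfl | rfl
  · simpa only [dirLT_one] using lt_or_gt_of_ne h
  · simpa only [dirLT_neg_one] using (lt_or_gt_of_ne h).symm

theorem ordConnected_setOf_dirLT (σ : ℤˣ) (x : X) : {y | DirLT σ x y}.OrdConnected := by
  rcases Int.units_eq_one_or σ with rfl | rfl
  · simp only [dirLT_one]; exact Set.ordConnected_Ioi
  · simp only [dirLT_neg_one]; exact Set.ordConnected_Iio

theorem mem_of_dirLT_of_dirLT {t : Set X} (ht : t.OrdConnected) {σ : ℤˣ} {x y z : X} (hx : x ∈ t)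
    (hz : z ∈ t) (hxy : DirLT σ x y) (hyz : DirLT σ y z) : y ∈ t := by
  rcases Int.units_eq_one_or σ with rfl | rfl
  · exact ht.out hx hz ⟨(dirLT_one.1 hxy).le, (dirLT_one.1 hyz).le⟩
  · exact ht.out hz hx ⟨(dirLT_neg_one.1 hyz).le, (dirLT_neg_one.1 hxy).le⟩

variable [TopologicalSpace X]

/-- The filter of one-sided neighbourhoods of `g.1` on the side `g.2`. -/
def side (g : Germ X) : Filter X := 𝓝[{y | DirLT g.2 g.1 y}] g.1

theorem side_one (x : X) : side (x, 1) = 𝓝[>] x := by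
  simp only [side, dirLT_one]; rfl

theorem side_neg_one (x : X) : side (x, -1) = 𝓝[<] x := by
  simp only [side, dirLT_neg_one]; rfl

theorem side_le_nhds (g : Germ X) : side g ≤ 𝓝 g.1 := nhdsWithin_le_nhds

theorem eventually_side_dirLT (g : Germ X) : ∀ᶠ y in side g, DirLT g.2 g.1 y :=
  eventually_mem_nhdsWithin

theorem eventually_side_ne (g : Germ X) : ∀ᶠ y in side g, y ≠ g.1 :=
  (eventually_side_dirLT g).mono fun _ h => h.ne.symm

theorem eventually_nhds_of_side {x : X} {p : X → Prop} (h : ∀ σ, ∀ᶠ y in side (x, σ), p y)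
    (hx : p x) : ∀ᶠ y in 𝓝 x, p y := by
  have hright := h 1
  have hleft := h (-1)
  rw [side_one, eventually_nhdsWithin_iff] at hright
  rw [side_neg_one, eventually_nhdsWithin_iff] at hleft
  filter_upwards [hright, hleft] with y hr hl
  rcases lt_trichotomy x y with hy | rfl | hy
  exacts [hr hy, hx, hl hy]

variable [OrderTopology X]

theorem exists_ordConnected_of_mem_side {g : Germ X} {s : Set X} (hs : s ∈ side g) :
    ∃ t ∈ side g, t ⊆ s ∧ t.OrdConnected ∧
      ∀ y ∈ t, ∀ z, DirLT g.2 g.1 z → DirLT g.2 z y → z ∈ t := by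
  obtain ⟨u, hu, hus⟩ := mem_nhdsWithin_iff_exists_mem_nhds_inter.1 hs
  set v := Set.ordConnectedComponent u g.1
  have hv : v ∈ 𝓝 g.1 := Set.ordConnectedComponent_mem_nhds.2 hu
  have hvc : v.OrdConnected := inferInstance
  refine ⟨v ∩ {y | DirLT g.2 g.1 y}, inter_mem (mem_nhdsWithin_of_mem_nhds hv) self_mem_nhdsWithin,
    ?_, hvc.inter (ordConnected_setOf_dirLT _ _), fun y hy z hgz hzy => ⟨?_, hgz⟩⟩
  · exact (Set.inter_subset_inter_left _ Set.ordConnectedComponent_subset).trans hus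
  · exact mem_of_dirLT_of_dirLT hvc (mem_of_mem_nhds hv) hy.1 hgz hzy

theorem side_neBot [DenselyOrdered X] {g : Germ X} (h : ∃ y, DirLT g.2 g.1 y) :
    (side g).NeBot := by
  obtain ⟨x, σ⟩ := g
  rcases Int.units_eq_one_or σ with rfl | rfl
  · simp only [dirLT_one] at h
    rw [side_one]
    exact nhdsGT_neBot_of_exists_gt h
  · simp only [dirLT_neg_one] at h
    rw [side_neg_one]
    exact nhdsLT_neBot_of_exists_lt h

end Germs

theorem eventually_side_dirLT_or {X : Type*} [ConditionallyCompleteLinearOrder X]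
    [DenselyOrdered X] [TopologicalSpace X] [OrderTopology X] {g : Germ X} {φ : X → X}
    (hφ : Continuous φ) (h : ∀ᶠ y in side g, φ y ≠ y) (σ : ℤˣ) :
    (∀ᶠ y in side g, DirLT σ (φ y) y) ∨ ∀ᶠ y in side g, DirLT σ y (φ y) := by
  obtain ⟨t, ht, hts, htc, -⟩ := exists_ordConnected_of_mem_side h
  have key : (∀ y ∈ t, φ y < y) ∨ ∀ y ∈ t, y < φ y :=
    htc.isPreconnected.subset_or_subset (isOpen_lt hφ continuous_id) (isOpen_lt continuous_id hφ)
      (Set.disjoint_left.2 fun y (hlt : φ y < y) (hgt : y < φ y) => hlt.asymm hgt)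
      (fun y hy => lt_or_gt_of_ne (hts hy))
  rcases Int.units_eq_one_or σ with rfl | rfl
  · simp only [dirLT_one]
    exact key.imp (mem_of_superset ht) (mem_of_superset ht)
  · simp only [dirLT_neg_one]
    exact key.symm.imp (mem_of_superset ht) (mem_of_superset ht)

/-! ### Step functions -/

section StepFunctions

variable {X α β γ : Type*} [LinearOrder X]

/-- `x` lies before the cut of the line given by the germ `g`. -/
def Before (x : X) (g : Germ X) : Prop := x < g.1 ∨ (x = g.1 ∧ g.2 = 1)

theorem before_one {x y : X} : Before x (y, 1) ↔ x ≤ y := by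
  simp [Before, le_iff_lt_or_eq]

theorem before_neg_one {x y : X} : Before x (y, -1) ↔ x < y := by
  simp [Before, show (-1 : ℤˣ) ≠ 1 by decide]

theorem before_iff_lt_of_ne {x y : X} (h : x ≠ y) (σ : ℤˣ) : Before x (y, σ) ↔ x < y := by
  simp [Before, h]

variable [TopologicalSpace X]

/-- A function on germs is a step function if at each germ it is the common value that it takes at
all nearby germs of the same side. -/
def IsStep (h : Germ X → α) : Prop := ∀ g, ∀ᶠ y in side g, ∀ σ, h (y, σ) = h g

theorem IsStep.map {h : Germ X → α} (hh : IsStep h) (φ : α → β) : IsStep fun g => φ (h g) :=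
  fun g => (hh g).mono fun _ hy σ => congrArg φ (hy σ)

theorem IsStep.map₂ {h : Germ X → α} {k : Germ X → β} (hh : IsStep h) (hk : IsStep k)
    (φ : α → β → γ) : IsStep fun g => φ (h g) (k g) := by
  intro g
  filter_upwards [hh g, hk g] with y hy ky σ
  rw [hy, ky]

theorem isStep_sum [AddCommMonoid α] {T : Finset X} {h : X → Germ X → α}
    (hh : ∀ u ∈ T, IsStep (h u)) : IsStep fun g => ∑ u ∈ T, h u g := by
  intro g
  filter_upwards [(Filter.eventually_all_finset T).2 fun u hu => hh u hu g] with y hy σ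
  exact Finset.sum_congr rfl fun u hu => hy u hu σ

theorem IsStep.eq_of_forall_eq [PreconnectedSpace X] {h : Germ X → α} (hh : IsStep h)
    (hjump : ∀ x, h (x, 1) = h (x, -1)) (g g' : Germ X) : h g = h g' := by
  have hside : ∀ x σ, h (x, σ) = h (x, 1) := fun x σ => by
    rcases Int.units_eq_one_or σ with rfl | rfl
    exacts [rfl, (hjump x).symm]
  have hconst : IsLocallyConstant fun y => h (y, 1) := by
    rw [IsLocallyConstant.iff_eventually_eq]
    refine fun x => eventually_nhds_of_side (fun σ => ?_) rfl
    filter_upwards [hh (x, σ)] with y hy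
    rw [hy 1, hside]
  calc h g = h (g.1, 1) := hside _ _
    _ = h (g'.1, 1) := hconst.apply_eq_of_preconnectedSpace _ _
    _ = h g' := (hside _ _).symm

variable [OrderTopology X]

theorem isStep_before (u : X) : IsStep (Before u) := by
  rintro ⟨x, σ⟩
  rcases lt_trichotomy u x with h | rfl | h
  · filter_upwards [(eventually_gt_nhds h).filter_mono (side_le_nhds (x, σ))] with y hy τ
    simp [Before, h, hy]
  · filter_upwards [eventually_side_dirLT (u, σ)] with y hy τ
    rw [before_iff_lt_of_ne hy.ne]
    rcases Int.units_eq_one_or σ with rfl | rfl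
    · simpa [before_one, dirLT_one] using hy
    · simpa [before_neg_one, dirLT_neg_one] using (dirLT_neg_one.1 hy).le
  · filter_upwards [(eventually_lt_nhds h).filter_mono (side_le_nhds (x, σ))] with y hy τ
    simp [Before, h.not_gt, h.ne', hy.not_gt, hy.ne']

open Classical in
theorem IsStep.sub_eq_sum [PreconnectedSpace X] [OrderBot X] [AddCommGroup α] {h : Germ X → α}
    (hh : IsStep h) (T : Finset X) (hT : ∀ u ∉ T, h (u, 1) = h (u, -1)) (g : Germ X) :
    h g - h (⊥, -1) = ∑ u ∈ T, if Before u g then h (u, 1) - h (u, -1) else 0 := by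
  set jumps : Germ X → α := fun g => ∑ u ∈ T, if Before u g then h (u, 1) - h (u, -1) else 0
  have hjumps : IsStep jumps := isStep_sum fun u _ =>
    (isStep_before u).map fun p => if p then h (u, 1) - h (u, -1) else 0
  have hjump : ∀ y, jumps (y, 1) - jumps (y, -1) = h (y, 1) - h (y, -1) := fun y => by
    have hterm : ∀ u, ((if Before u (y, 1) then h (u, 1) - h (u, -1) else 0) -
        if Before u (y, -1) then h (u, 1) - h (u, -1) else 0) =
          if u = y then h (u, 1) - h (u, -1) else 0 := fun u => by
      rcases lt_trichotomy u y with huy | rfl | huy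
      · simp [before_one, before_neg_one, huy, huy.le, huy.ne]
      · simp [before_one, before_neg_one]
      · simp [before_one, before_neg_one, huy.not_ge, huy.not_gt, huy.ne']
    rw [← Finset.sum_sub_distrib, Finset.sum_congr rfl fun u _ => hterm u, Finset.sum_ite_eq']
    split_ifs with hy
    exacts [rfl, by rw [hT y hy, sub_self]]
  have hbot : jumps (⊥, -1) = 0 := by simp [jumps, before_neg_one]
  have hconst : h g - jumps g = h (⊥, -1) - jumps (⊥, -1) :=
    (hh.map₂ hjumps (· - ·)).eq_of_forall_eq
      (fun y => by rw [sub_eq_sub_iff_sub_eq_sub]; exact (hjump y).symm) g _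
  rw [hbot, sub_zero] at hconst
  rw [← hconst, sub_sub_cancel]

end StepFunctions

/-! ### The action of a turning map on germs -/

section GermMap

variable {X : Type*} [LinearOrder X]

open Classical in
/-- The direction along the germ `g` of a map with direction `ω` to the left of `c` and `-ω` to its
right. -/
noncomputable def lapSign (c : X) (ω : ℤˣ) (g : Germ X) : ℤˣ := if Before c g then -ω else ω

/-- The action on germs of a map `f` with direction `ω` to the left of `c` and `-ω` to its right. -/
noncomputable def germMap (f : X → X) (c : X) (ω : ℤˣ) (g : Germ X) : Germ X :=
  (f g.1, g.2 * lapSign c ω g)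

/-- The direction of the `n`-th iterate of `f` along the germ `g`. -/
noncomputable def iterSign (f : X → X) (c : X) (ω : ℤˣ) (n : ℕ) (g : Germ X) : ℤˣ :=
  g.2 * ((germMap f c ω)^[n] g).2

/-- The closed side of `c` on which a map with direction `ω` to the left of `c` and `-ω` to its
right has direction `η`. -/
def lap (c : X) (ω η : ℤˣ) : Set X := {x | (η = ω ∧ x ≤ c) ∨ (η = -ω ∧ c ≤ x)}

variable {f : X → X} {c : X} {ω : ℤˣ}

theorem lapSign_of_lt {x : X} (h : x < c) (σ : ℤˣ) : lapSign c ω (x, σ) = ω := by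
  simp [lapSign, Before, h.not_gt, h.ne']

theorem lapSign_of_gt {x : X} (h : c < x) (σ : ℤˣ) : lapSign c ω (x, σ) = -ω := by
  simp [lapSign, Before, h]

theorem lapSign_of_ne {x : X} (h : x ≠ c) (σ τ : ℤˣ) : lapSign c ω (x, σ) = lapSign c ω (x, τ) := by
  rcases lt_or_gt_of_ne h with h | h
  · rw [lapSign_of_lt h, lapSign_of_lt h]
  · rw [lapSign_of_gt h, lapSign_of_gt h]

theorem lapSign_self (σ : ℤˣ) : lapSign c ω (c, σ) = -σ * ω := by
  rcases Int.units_eq_one_or σ with rfl | rfl <;> simp [lapSign, before_one, before_neg_one]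

theorem mem_lap_lapSign (g : Germ X) : g.1 ∈ lap c ω (lapSign c ω g) := by
  unfold lapSign lap
  split_ifs with h
  · exact Or.inr ⟨rfl, h.elim le_of_lt fun h => h.1.le⟩
  · exact Or.inl ⟨rfl, not_lt.1 fun h' => h (Or.inl h')⟩

theorem mem_lap_or_mem_lap_neg (x : X) : x ∈ lap c ω ω ∨ x ∈ lap c ω (-ω) :=
  (le_total x c).imp (fun h => Or.inl ⟨rfl, h⟩) fun h => Or.inr ⟨rfl, h⟩

theorem germMap_turning (σ : ℤˣ) : germMap f c ω (c, σ) = (f c, -ω) := by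
  simp only [germMap, lapSign_self, ← mul_assoc, mul_neg, Int.units_mul_self, neg_one_mul]

theorem germMap_iterate_fst (n : ℕ) (g : Germ X) : ((germMap f c ω)^[n] g).1 = f^[n] g.1 := by
  induction n generalizing g with
  | zero => rfl
  | succ n ih => rw [Function.iterate_succ_apply, ih, Function.iterate_succ_apply]; rfl

theorem germMap_iterate_snd (n : ℕ) (g : Germ X) :
    ((germMap f c ω)^[n] g).2 = g.2 * iterSign f c ω n g := by
  rw [iterSign, ← mul_assoc, Int.units_mul_self, one_mul]

theorem germMap_iterate_eq (n : ℕ) (g : Germ X) :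
    (germMap f c ω)^[n] g = (f^[n] g.1, g.2 * iterSign f c ω n g) :=
  Prod.ext (germMap_iterate_fst n g) (germMap_iterate_snd n g)

theorem iterSign_zero (g : Germ X) : iterSign f c ω 0 g = 1 := Int.units_mul_self _

theorem iterSign_add (m n : ℕ) (g : Germ X) :
    iterSign f c ω (m + n) g =
      iterSign f c ω m g * iterSign f c ω n ((germMap f c ω)^[m] g) := by
  rw [iterSign, add_comm m n, Function.iterate_add_apply, germMap_iterate_snd,
    germMap_iterate_snd m, mul_assoc g.2, ← mul_assoc, Int.units_mul_self, one_mul]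

theorem iterSign_one (g : Germ X) : iterSign f c ω 1 g = lapSign c ω g := by
  rw [iterSign, Function.iterate_one, germMap, ← mul_assoc, Int.units_mul_self, one_mul]

theorem iterSign_succ (n : ℕ) (g : Germ X) :
    iterSign f c ω (n + 1) g = lapSign c ω g * iterSign f c ω n (germMap f c ω g) := by
  rw [add_comm, iterSign_add, iterSign_one, Function.iterate_one]

theorem germMap_iterate_eq_of_hit {n i : ℕ} {u : X} (hu : f^[i] u = c) (hi : i < n) (σ τ : ℤˣ) :
    (germMap f c ω)^[n] (u, σ) = (germMap f c ω)^[n - i] (c, τ) := by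
  obtain ⟨m, rfl⟩ : ∃ m, n = m + 1 + i := ⟨n - i - 1, by omega⟩
  rw [Function.iterate_add_apply, germMap_iterate_eq i, hu, Function.iterate_succ_apply,
    germMap_turning, Nat.add_sub_cancel, Function.iterate_succ_apply, germMap_turning]

theorem iterSign_eq_of_not_hit {n : ℕ} {u : X} (hu : ∀ j < n, f^[j] u ≠ c) (σ τ : ℤˣ) :
    iterSign f c ω n (u, σ) = iterSign f c ω n (u, τ) := by
  induction n with
  | zero => rw [iterSign_zero, iterSign_zero]
  | succ n ih =>
    rw [iterSign_add, iterSign_add, ih fun j hj => hu j (by omega), iterSign_one, iterSign_one,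
      germMap_iterate_eq, germMap_iterate_eq, lapSign_of_ne (hu n (by omega))]

theorem iterSign_eq_of_hit {n i : ℕ} {u : X} (hu : f^[i] u = c) (hi : i < n) (σ : ℤˣ) :
    iterSign f c ω n (u, σ) = -σ * iterSign f c ω (n - i) (c, -1) := by
  rw [iterSign, germMap_iterate_eq_of_hit hu hi σ (-1), germMap_iterate_snd]
  simp only [neg_mul, one_mul, mul_neg]

theorem iterSign_sub_iterSign_of_hit {n i : ℕ} {u : X} (hu : f^[i] u = c) (hi : i < n) :
    (iterSign f c ω n (u, 1) : ℤ) - iterSign f c ω n (u, -1) =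
      -2 * (iterSign f c ω (n - i) (c, -1) : ℤ) := by
  rw [iterSign_eq_of_hit hu hi, iterSign_eq_of_hit hu hi]
  push_cast
  ring

variable [TopologicalSpace X]

/-- `f` is continuous and strictly monotone on either side of `c`, with direction `ω` on the left
and `-ω` on the right. Unlike in `IsUnimodal`, the point `c` may be an endpoint. -/
structure IsTurning (f : X → X) (c : X) (ω : ℤˣ) : Prop where
  continuous : Continuous f
  left : ∀ x y, x < y → y ≤ c → DirLT ω (f x) (f y)
  right : ∀ x y, c ≤ x → x < y → DirLT (-ω) (f x) (f y)

theorem IsTurning.dirLT_of_mem_lap (hf : IsTurning f c ω) {η σ : ℤˣ} {x y : X}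
    (hx : x ∈ lap c ω η) (hy : y ∈ lap c ω η) (h : DirLT σ x y) : DirLT (σ * η) (f x) (f y) := by
  have hlap : (η = ω ∧ x ≤ c ∧ y ≤ c) ∨ (η = -ω ∧ c ≤ x ∧ c ≤ y) := by
    have hω : ω ≠ -ω := by
      rcases Int.units_eq_one_or ω with rfl | rfl <;> decide
    rcases hx with ⟨rfl, hx⟩ | ⟨rfl, hx⟩ <;> rcases hy with ⟨h, hy⟩ | ⟨h, hy⟩
    exacts [Or.inl ⟨rfl, hx, hy⟩, absurd h hω, absurd h.symm hω, Or.inr ⟨rfl, hx, hy⟩]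
  rcases Int.units_eq_one_or σ with rfl | rfl
  · rw [one_mul]
    rw [dirLT_one] at h
    rcases hlap with ⟨rfl, -, hy⟩ | ⟨rfl, hx, -⟩
    exacts [hf.left x y h hy, hf.right x y hx h]
  · rw [neg_one_mul, dirLT_neg]
    rw [dirLT_neg_one] at h
    rcases hlap with ⟨rfl, hx, -⟩ | ⟨rfl, -, hy⟩
    exacts [hf.left y x h hx, hf.right y x hy h]

theorem IsTurning.injOn_lap (hf : IsTurning f c ω) (η : ℤˣ) : Set.InjOn f (lap c ω η) := by
  intro x hx y hy hxy
  by_contra hne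
  rcases dirLT_or_dirLT 1 hne with h | h
  · exact (hf.dirLT_of_mem_lap hx hy h).ne hxy
  · exact (hf.dirLT_of_mem_lap hy hx h).ne hxy.symm

variable [OrderTopology X]

theorem isStep_lapSign : IsStep (lapSign c ω) := by
  classical exact (isStep_before c).map fun p => if p then -ω else ω

theorem eventually_mem_lap (g : Germ X) : ∀ᶠ y in side g, y ∈ lap c ω (lapSign c ω g) := by
  filter_upwards [isStep_lapSign (c := c) (ω := ω) g] with y hy
  simpa only [hy] using mem_lap_lapSign (c := c) (ω := ω) (y, 1)

theorem IsTurning.tendsto_side (hf : IsTurning f c ω) (g : Germ X) :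
    Tendsto f (side g) (side (germMap f c ω g)) := by
  refine tendsto_nhdsWithin_iff.2 ⟨(hf.continuous.tendsto g.1).mono_left (side_le_nhds g), ?_⟩
  filter_upwards [eventually_mem_lap (c := c) (ω := ω) g, eventually_side_dirLT g] with y hy hd
  exact hf.dirLT_of_mem_lap (mem_lap_lapSign g) hy hd

theorem IsTurning.tendsto_side_iterate (hf : IsTurning f c ω) (n : ℕ) (g : Germ X) :
    Tendsto f^[n] (side g) (side ((germMap f c ω)^[n] g)) := by
  induction n generalizing g with
  | zero => exact tendsto_id
  | succ n ih => exact (ih _).comp (hf.tendsto_side g)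

theorem IsTurning.eventually_dirLT_iterate (hf : IsTurning f c ω) (n : ℕ) (g : Germ X) :
    ∀ᶠ p in side g ×ˢ side g, DirLT g.2 p.1 p.2 →
      DirLT ((germMap f c ω)^[n] g).2 (f^[n] p.1) (f^[n] p.2) := by
  induction n generalizing g with
  | zero => exact Eventually.of_forall fun p h => h
  | succ n ih =>
    have hlap := eventually_mem_lap (c := c) (ω := ω) g
    filter_upwards [((hf.tendsto_side g).prodMap (hf.tendsto_side g)).eventually (ih _),
      hlap.prod_mk hlap] with p hlt hmem h
    exact hlt (hf.dirLT_of_mem_lap hmem.1 hmem.2 h)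

theorem IsTurning.isStep_iterSign (hf : IsTurning f c ω) (n : ℕ) : IsStep (iterSign f c ω n) := by
  induction n with
  | zero => exact fun g => Eventually.of_forall fun y σ => by rw [iterSign_zero, iterSign_zero]
  | succ n ih =>
    intro g
    filter_upwards [isStep_lapSign (c := c) (ω := ω) g, (hf.tendsto_side g).eventually (ih _)]
      with y hlap hiter σ
    rw [iterSign_succ, iterSign_succ, hlap]
    exact congrArg _ (hiter _)

end GermMap

/-! ### Preimages of the turning point and the kneading identity -/

section Kneading

/-- The points whose orbit meets `c` before time `n`. -/
def hitSet {X : Type*} (f : X → X) (c : X) (n : ℕ) : Set X := {u | ∃ i < n, f^[i] u = c}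

/-- The points whose orbit meets `c` for the first time at time `i`. -/
def firstHit {X : Type*} (f : X → X) (c : X) (i : ℕ) : Set X :=
  {u | f^[i] u = c ∧ ∀ j < i, f^[j] u ≠ c}

theorem hitSet_eq_iUnion_firstHit {X : Type*} (f : X → X) (c : X) (n : ℕ) :
    hitSet f c n = ⋃ i ∈ Finset.range n, firstHit f c i := by
  ext u
  simp only [hitSet, firstHit, Set.mem_iUnion, Finset.mem_range, exists_prop, Set.mem_ofPred_eq]
  constructor
  · rintro ⟨i, hi, hu⟩
    classical
    have hex : ∃ j, f^[j] u = c := ⟨i, hu⟩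
    exact ⟨Nat.find hex, (Nat.find_min' hex hu).trans_lt hi, Nat.find_spec hex,
      fun j hj => Nat.find_min hex hj⟩
  · rintro ⟨i, hi, hu, -⟩
    exact ⟨i, hi, hu⟩

theorem disjoint_firstHit {X : Type*} (f : X → X) (c : X) {i j : ℕ} (hij : i ≠ j) :
    Disjoint (firstHit f c i) (firstHit f c j) := by
  refine Set.disjoint_left.2 fun u hi hj => ?_
  rcases lt_or_gt_of_ne hij with h | h
  · exact hj.2 i h hi.1
  · exact hi.2 j h hj.1

variable {X : Type*} [LinearOrder X] {f : X → X} {c : X} {ω : ℤˣ}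

/-- The number of points of `firstHit f c i` before the cut given by `g`. -/
noncomputable def hitCount (f : X → X) (c : X) (i : ℕ) (g : Germ X) : ℤ :=
  ({u ∈ firstHit f c i | Before u g}.ncard : ℤ)

variable [TopologicalSpace X]

theorem IsTurning.finite_preimage (hf : IsTurning f c ω) (i : ℕ) : {u | f^[i] u = c}.Finite := by
  induction i with
  | zero => simp
  | succ i ih =>
    have hlap : ∀ η, (lap c ω η ∩ f ⁻¹' {u | f^[i] u = c}).Finite := fun η => by
      refine Set.Finite.of_finite_image (f := f) (ih.subset ?_)
        ((hf.injOn_lap η).mono Set.inter_subset_left)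
      rintro _ ⟨x, hx, rfl⟩
      exact hx.2
    refine ((hlap ω).union (hlap (-ω))).subset fun u hu => ?_
    exact (mem_lap_or_mem_lap_neg u).imp (fun h => ⟨h, hu⟩) fun h => ⟨h, hu⟩

theorem IsTurning.finite_hitSet (hf : IsTurning f c ω) (n : ℕ) : (hitSet f c n).Finite :=
  ((Set.finite_lt_nat n).biUnion fun i _ => hf.finite_preimage i).subset fun u hu => by
    simpa [hitSet] using hu

theorem IsTurning.finite_firstHit (hf : IsTurning f c ω) (i : ℕ) : (firstHit f c i).Finite :=
  (hf.finite_preimage i).subset fun _ h => h.1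

theorem IsTurning.sum_hitSet {M : Type*} [AddCommMonoid M] (hf : IsTurning f c ω) (n : ℕ)
    (φ : X → M) :
    ∑ u ∈ (hf.finite_hitSet n).toFinset, φ u =
      ∑ i ∈ Finset.range n, ∑ u ∈ (hf.finite_firstHit i).toFinset, φ u := by
  classical
  rw [← Finset.sum_biUnion fun i _ j _ hij => ?_]
  · congr 1
    rw [← Finset.coe_inj, Finset.coe_biUnion]
    simp only [Set.Finite.coe_toFinset, hitSet_eq_iUnion_firstHit, Finset.mem_coe]
  · simpa only [Function.onFun, Set.Finite.disjoint_toFinset] using disjoint_firstHit f c hij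

open Classical in
theorem IsTurning.hitCount_eq_sum (hf : IsTurning f c ω) (i : ℕ) (g : Germ X) :
    hitCount f c i g =
      ∑ u ∈ (hf.finite_firstHit i).toFinset, if Before u g then (1 : ℤ) else 0 := by
  rw [Finset.sum_boole, hitCount,
    Set.ncard_eq_toFinset_card _ ((hf.finite_firstHit i).subset (Set.sep_subset _ _))]
  congr 2
  ext u
  simp only [Set.Finite.mem_toFinset, Set.mem_sep_iff, Finset.mem_filter]

open Classical in
theorem IsTurning.sum_hitSet_jump (hf : IsTurning f c ω) (n : ℕ) {cut : X → Germ X}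
    {γ : ℕ → Germ X} (hcut : ∀ i < n, ∀ u ∈ firstHit f c i, cut u = γ i) :
    ∑ u ∈ (hf.finite_hitSet n).toFinset,
        (if Before u (cut u) then (iterSign f c ω n (u, 1) : ℤ) - iterSign f c ω n (u, -1) else 0) =
      -2 * ∑ i ∈ Finset.range n,
        (iterSign f c ω (n - i) (c, -1) : ℤ) * hitCount f c i (γ i) := by
  rw [hf.sum_hitSet, Finset.mul_sum]
  refine Finset.sum_congr rfl fun i hi => ?_
  rw [hf.hitCount_eq_sum, Finset.mul_sum, Finset.mul_sum]
  refine Finset.sum_congr rfl fun u hu => ?_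
  rw [Set.Finite.mem_toFinset] at hu
  rw [Finset.mem_range] at hi
  rw [iterSign_sub_iterSign_of_hit hu.1 hi, hcut i hi u hu]
  split_ifs <;> ring

theorem IsTurning.iterSign_sub_iterSign_bot [OrderTopology X] [PreconnectedSpace X] [OrderBot X]
    (hf : IsTurning f c ω) (n : ℕ) (g : Germ X) :
    (iterSign f c ω n g : ℤ) - iterSign f c ω n (⊥, -1) =
      -2 * ∑ i ∈ Finset.range n, (iterSign f c ω (n - i) (c, -1) : ℤ) * hitCount f c i g := by
  have hstep : IsStep fun g => (iterSign f c ω n g : ℤ) :=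
    (hf.isStep_iterSign n).map fun σ => (σ : ℤ)
  rw [hstep.sub_eq_sum (hf.finite_hitSet n).toFinset (fun u hu => ?_) g,
    hf.sum_hitSet_jump n fun _ _ _ _ => rfl]
  simp only [Set.Finite.mem_toFinset, hitSet, Set.mem_ofPred_eq, not_exists, not_and] at hu
  rw [iterSign_eq_of_not_hit hu 1 (-1)]

end Kneading

/-! ### Repelling periodic points and finiteness of fixed points -/

section Repelling

theorem IsRepelling.exists_nhds {X : Type*} [TopologicalSpace X] {f : X → X} (hf : Continuous f)
    {x : X} (h : IsRepelling f x) {n : ℕ} (hn : 1 ≤ n) (hx : f^[n] x = x) :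
    ∃ V ∈ 𝓝 x, ∀ y ∈ V, y ≠ x → ∃ k, (f^[n])^[k] y ∉ V := by
  obtain ⟨-, U, hUo, hxU, hU⟩ := h
  set p := Function.minimalPeriod f x
  obtain ⟨q, rfl⟩ : p ∣ n := Function.IsPeriodicPt.minimalPeriod_dvd hx
  have hq : 0 < q := Nat.pos_of_ne_zero (by rintro rfl; simp at hn)
  -- `V` is chosen so that orbits of `f^[p * q]` in `V` give orbits of `f^[p]` in `U`.
  refine ⟨⋂ j ∈ Finset.range q, f^[p * j] ⁻¹' U, ?_, fun y hy hyx => ?_⟩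
  · rw [Filter.biInter_finset_mem]
    intro j _
    apply (hf.iterate _).continuousAt
    rw [(Function.isPeriodicPt_minimalPeriod f x).mul_const j]
    exact hUo.mem_nhds hxU
  · simp only [Set.mem_iInter, Finset.mem_range, Set.mem_preimage] at hy ⊢
    by_contra! hall
    obtain ⟨k, hk⟩ := hU y (by simpa using hy 0 hq) hyx
    refine hk ?_
    have hmem := hall (k / q) (k % q) (Nat.mod_lt _ hq)
    rwa [← Function.iterate_mul, ← Function.iterate_add_apply, mul_assoc, ← mul_add,
      Nat.mod_add_div] at hmem

theorem IsRepelling.eventually_ne_of_ne {X : Type*} [TopologicalSpace X] {f : X → X}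
    (hf : Continuous f) {x : X} (h : IsRepelling f x) {n : ℕ} (hn : 1 ≤ n) (hx : f^[n] x = x) :
    ∀ᶠ y in 𝓝 x, y ≠ x → f^[n] y ≠ y := by
  obtain ⟨V, hV, hrep⟩ := h.exists_nhds hf hn hx
  filter_upwards [hV] with y hy hne hfix
  obtain ⟨k, hk⟩ := hrep y hy hne
  exact hk ((Function.iterate_fixed hfix k).symm ▸ hy)

section MovesInward

variable {X : Type*} [LinearOrder X] [TopologicalSpace X]

/-- `φ` moves the points close to the germ `g` in the direction of its base point. They may jump
over it. -/
def MovesInward (φ : X → X) (g : Germ X) : Prop := ∀ᶠ y in side g, DirLT g.2 (φ y) y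

variable [OrderTopology X]

theorem MovesInward.eventually_forall_iterate_mem {φ : X → X} {g : Germ X} (h : MovesInward φ g)
    (hside : Tendsto φ (side g) (side g)) {V : Set X} (hV : V ∈ 𝓝 g.1) :
    ∀ᶠ y in side g, ∀ k, φ^[k] y ∈ V := by
  obtain ⟨t, ht, hts, -, hsub⟩ := exists_ordConnected_of_mem_side
    (inter_mem (inter_mem (hside.eventually (eventually_side_dirLT g)) h) (side_le_nhds g hV))
  have hφ : Set.MapsTo φ t t := fun y hy => hsub y hy _ (hts hy).1.1 (hts hy).1.2
  filter_upwards [ht] with y hy k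
  exact (hts (hφ.iterate k hy)).2

theorem IsRepelling.not_movesInward {f : X → X} (hf : Continuous f) {g : Germ X}
    (h : IsRepelling f g.1) [(side g).NeBot] {n : ℕ} (hn : 1 ≤ n) (hx : f^[n] g.1 = g.1)
    (hside : Tendsto f^[n] (side g) (side g)) : ¬ MovesInward f^[n] g := by
  intro hin
  obtain ⟨V, hV, hrep⟩ := h.exists_nhds hf hn hx
  obtain ⟨y, ⟨hstay, hne⟩, hyV⟩ := ((hin.eventually_forall_iterate_mem hside hV).and
    (eventually_side_ne g)).and (side_le_nhds g hV) |>.exists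
  obtain ⟨k, hk⟩ := hrep y hyV hne
  exact hk (hstay k)

end MovesInward

section DenselyOrdered

variable {X : Type*} [ConditionallyCompleteLinearOrder X] [TopologicalSpace X] [OrderTopology X]
  [DenselyOrdered X] {f φ : X → X} {c : X} {ω : ℤˣ}

theorem exists_first_fixedPoint (hφ : Continuous φ) {w z : X} (hwz : w ≤ z) (hw : w < φ w)
    (hz : φ z = z) : ∃ v ∈ Set.Ioc w z, φ v = v ∧ ∀ u ∈ Set.Ico w v, u < φ u := by
  have hcompact : IsCompact (Set.Icc w z ∩ Function.fixedPoints φ) :=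
    isCompact_Icc.inter_right (isClosed_fixedPoints hφ)
  obtain ⟨v, ⟨hvI, hv⟩, hfirst⟩ := hcompact.exists_isLeast ⟨z, ⟨hwz, le_rfl⟩, hz⟩
  have hne : w ≠ v := by rintro rfl; exact hw.ne' hv
  refine ⟨v, ⟨hvI.1.lt_of_ne hne, hvI.2⟩, hv, fun u hu => ?_⟩
  by_contra! hle
  obtain ⟨u', hu', hfix⟩ := exists_mem_Icc_isFixedPt hφ.continuousOn hu.1 hw.le hle
  exact (hfirst ⟨⟨hu'.1, hu'.2.trans (hu.2.le.trans hvI.2)⟩, hfix⟩).not_gt (hu'.2.trans_lt hu.2)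

theorem exists_last_fixedPoint (hφ : Continuous φ) {y w : X} (hyw : y ≤ w) (hw : φ w < w)
    (hy : φ y = y) : ∃ v ∈ Set.Ico y w, φ v = v ∧ ∀ u ∈ Set.Ioc v w, φ u < u := by
  obtain ⟨v, ⟨hwv, hvy⟩, hv, hlt⟩ := exists_first_fixedPoint (X := Xᵒᵈ)
    (φ := OrderDual.toDual ∘ φ ∘ OrderDual.ofDual) hφ (OrderDual.toDual_le_toDual.2 hyw)
    (OrderDual.toDual_lt_toDual.2 hw) (congrArg OrderDual.toDual hy)
  exact ⟨v.ofDual, ⟨hvy, hwv⟩, hv, fun u hu => hlt (OrderDual.toDual u) ⟨hu.2, hu.1⟩⟩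

theorem exists_movesInward_of_strictMonoOn (hφ : Continuous φ) {y w z : X}
    (hmono : StrictMonoOn φ (Set.Icc y z)) (hw : w ∈ Set.Ioo y z) (hy : φ y = y) (hz : φ z = z)
    (hne : φ w ≠ w) :
    ∃ g : Germ X, g.1 ∈ Set.Icc y z ∧ φ g.1 = g.1 ∧ (side g).NeBot ∧
      Tendsto φ (side g) (side g) ∧ MovesInward φ g := by
  have htendsto : ∀ (v : X) (σ : ℤˣ), φ v = v → (∀ᶠ u in side (v, σ), DirLT σ v (φ u)) →
      Tendsto φ (side (v, σ)) (side (v, σ)) := fun v σ hv hu => by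
    refine tendsto_nhdsWithin_iff.2 ⟨?_, hu⟩
    simpa only [hv] using (hφ.tendsto v).mono_left (side_le_nhds (v, σ))
  rcases lt_or_gt_of_ne hne with hlt | hgt
  · obtain ⟨v, hvI, hv, hin⟩ := exists_last_fixedPoint hφ hw.1.le hlt hy
    have hvyz : v ∈ Set.Icc y z := ⟨hvI.1, hvI.2.le.trans hw.2.le⟩
    have hnear : ∀ᶠ u in side (v, (1 : ℤˣ)), u ∈ Set.Ioo v w := by
      rw [side_one]; exact Ioo_mem_nhdsGT hvI.2
    refine ⟨(v, 1), hvyz, hv, side_neBot ⟨w, dirLT_one.2 hvI.2⟩, htendsto v 1 hv ?_, ?_⟩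
    · filter_upwards [hnear] with u hu
      have := hmono hvyz ⟨hvI.1.trans hu.1.le, hu.2.le.trans hw.2.le⟩ hu.1
      rwa [hv, ← dirLT_one] at this
    · filter_upwards [hnear] with u hu using dirLT_one.2 (hin u ⟨hu.1, hu.2.le⟩)
  · obtain ⟨v, hvI, hv, hin⟩ := exists_first_fixedPoint hφ hw.2.le hgt hz
    have hvyz : v ∈ Set.Icc y z := ⟨hw.1.le.trans hvI.1.le, hvI.2⟩
    have hnear : ∀ᶠ u in side (v, (-1 : ℤˣ)), u ∈ Set.Ioo w v := by
      rw [side_neg_one]; exact Ioo_mem_nhdsLT hvI.1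
    refine ⟨(v, -1), hvyz, hv, side_neBot ⟨w, dirLT_neg_one.2 hvI.1⟩, htendsto v (-1) hv ?_, ?_⟩
    · filter_upwards [hnear] with u hu
      have := hmono ⟨hw.1.le.trans hu.1.le, hu.2.le.trans hvI.2⟩ hvyz hu.2
      rwa [hv, ← dirLT_neg_one] at this
    · filter_upwards [hnear] with u hu using dirLT_neg_one.2 (hin u ⟨hu.1.le, hu.2⟩)

theorem IsTurning.exists_hit_of_iterate_eq (hf : IsTurning f c ω) {n : ℕ} {u v : X} (huv : u < v)
    (h : f^[n] u = f^[n] v) : ∃ w ∈ Set.Ioo u v, w ∈ hitSet f c n := by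
  induction n generalizing u v with
  | zero => exact absurd h huv.ne
  | succ n ih =>
    rw [Function.iterate_succ_apply, Function.iterate_succ_apply] at h
    have hpull : ∀ w' ∈ hitSet f c n, (∃ w ∈ Set.Ioo u v, f w = w') →
        ∃ w ∈ Set.Ioo u v, w ∈ hitSet f c (n + 1) := by
      rintro _ ⟨i, hi, hc⟩ ⟨w, hw, rfl⟩
      exact ⟨w, hw, i + 1, by omega, hc⟩
    rcases lt_trichotomy (f u) (f v) with hlt | heq | hgt
    · obtain ⟨w', hw', hhit⟩ := ih hlt h
      exact hpull w' hhit (intermediate_value_Ioo huv.le hf.continuous.continuousOn hw')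
    · refine ⟨c, ⟨?_, ?_⟩, 0, by omega, rfl⟩
      · by_contra! hcu
        exact (hf.right u v hcu huv).ne heq
      · by_contra! hvc
        exact (hf.left u v huv hvc).ne heq
    · obtain ⟨w', hw', hhit⟩ := ih hgt h.symm
      exact hpull w' hhit (intermediate_value_Ioo' huv.le hf.continuous.continuousOn hw')

theorem IsTurning.strictMonoOn_iterate (hf : IsTurning f c ω) {n : ℕ} {y z : X} (hyz : y ≤ z)
    (hno : ∀ w ∈ Set.Icc y z, w ∉ hitSet f c n) (hle : f^[n] y ≤ f^[n] z) :
    StrictMonoOn f^[n] (Set.Icc y z) := by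
  refine ContinuousOn.strictMonoOn_of_injOn_Icc hyz hle (hf.continuous.iterate n).continuousOn ?_
  have hlt : ∀ u ∈ Set.Icc y z, ∀ v ∈ Set.Icc y z, u < v → f^[n] u ≠ f^[n] v :=
    fun u hu v hv huv heq =>
      let ⟨w, hw, hhit⟩ := hf.exists_hit_of_iterate_eq huv heq
      hno w ⟨hu.1.trans hw.1.le, hw.2.le.trans hv.2⟩ hhit
  intro u hu v hv huv
  by_contra hne
  rcases lt_or_gt_of_ne hne with h | h
  exacts [hlt u hu v hv h huv, hlt v hv u hu h huv.symm]

theorem IsTurning.exists_between_fixedPoints (hf : IsTurning f c ω) {n : ℕ} (hn : 1 ≤ n) {y z : X}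
    (hyz : y < z) (hy : f^[n] y = y) (hz : f^[n] z = z) :
    ∃ w ∈ Set.Icc y z,
      w ∈ hitSet f c n ∪ {x ∈ Function.periodicPts f | ¬ IsRepelling f x} := by
  by_contra! hno
  have hrep : ∀ w ∈ Set.Icc y z, f^[n] w = w → IsRepelling f w := fun w hw hfix =>
    by_contra fun h => hno w hw (Or.inr ⟨⟨n, hn, hfix⟩, h⟩)
  have hcont := hf.continuous.iterate n
  have hmono : StrictMonoOn f^[n] (Set.Icc y z) :=
    hf.strictMonoOn_iterate hyz.le (fun w hw h => hno w hw (Or.inl h))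
      (by rw [hy, hz]; exact hyz.le)
  have : (𝓝[>] y).NeBot := nhdsGT_neBot_of_exists_gt ⟨z, hyz⟩
  have hisolated := (hrep y ⟨le_rfl, hyz.le⟩ hy).eventually_ne_of_ne hf.continuous hn hy
  have hnear : ∀ᶠ w in 𝓝[>] y, w ∈ Set.Ioo y z := Ioo_mem_nhdsGT hyz
  obtain ⟨w, hw, hne⟩ := (hnear.and (nhdsWithin_le_nhds hisolated)).exists
  obtain ⟨g, hg, hfix, hbot, hside, hin⟩ :=
    exists_movesInward_of_strictMonoOn hcont hmono hw hy hz (hne hw.1.ne')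
  exact (hrep g.1 hg hfix).not_movesInward hf.continuous hn hfix hside hin

end DenselyOrdered

theorem finite_of_separated {X : Type*} [LinearOrder X] {S T : Set X} (hT : T.Finite)
    (hsep : ∀ y ∈ S, ∀ z ∈ S, y < z → ∃ w ∈ Set.Icc y z, w ∈ T) : S.Finite := by
  suffices h : (S \ T).Finite from (h.union hT).subset (Set.subset_sdiff_union S T)
  have hlt : ∀ y ∈ S \ T, ∀ z ∈ S \ T, y < z → {u ∈ T | u < y} ≠ {u ∈ T | u < z} :=
    fun y hy z hz hyz heq => by
      obtain ⟨w, hw, hwT⟩ := hsep y hy.1 z hz.1 hyz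
      have hwz : w ∈ {u ∈ T | u < z} := ⟨hwT, hw.2.lt_of_ne fun h => hz.2 (h ▸ hwT)⟩
      rw [← heq] at hwz
      exact hwz.2.not_ge hw.1
  refine Set.Finite.of_injOn (f := fun x => {u ∈ T | u < x}) (t := 𝒫 T)
    (fun x _ => Set.sep_subset _ _) (fun y hy z hz heq => ?_) hT.finite_subsets
  by_contra hne
  rcases lt_or_gt_of_ne hne with h | h
  exacts [hlt y hy z hz h heq, hlt z hz y hy h heq.symm]

theorem IsTurning.finite_fixedPoints {X : Type*} [ConditionallyCompleteLinearOrder X]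
    [TopologicalSpace X] [OrderTopology X] [DenselyOrdered X] {f : X → X} {c : X} {ω : ℤˣ}
    (hf : IsTurning f c ω) (hrep : {x ∈ Function.periodicPts f | ¬ IsRepelling f x}.Finite)
    {n : ℕ} (hn : 1 ≤ n) : (Function.fixedPoints f^[n]).Finite :=
  finite_of_separated ((hf.finite_hitSet n).union hrep) fun _ hy _ hz hyz =>
    hf.exists_between_fixedPoints hn hyz hy hz

end Repelling

/-! ### Counting fixed points of iterates -/

section MovesRight

variable {X : Type*} [TopologicalSpace X]

/-- `φ` moves the points close to the germ `g` to the right. If the base point is fixed, this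
depends on the side of `g`, and an empty side counts as moved inward. -/
def MovesRight [LinearOrder X] (φ : X → X) (g : Germ X) : Prop :=
  g.1 < φ g.1 ∨ (φ g.1 = g.1 ∧ (MovesInward φ g ↔ g.2 = -1))

theorem movesRight_iff_of_ne [LinearOrder X] {φ : X → X} {x : X} (h : φ x ≠ x) (σ : ℤˣ) :
    MovesRight φ (x, σ) ↔ x < φ x := by
  simp [MovesRight, h]

theorem movesRight_iff_of_eq [LinearOrder X] {φ : X → X} {g : Germ X} (h : φ g.1 = g.1) :
    MovesRight φ g ↔ (MovesInward φ g ↔ g.2 = -1) := by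
  simp [MovesRight, h]

theorem not_movesRight_top [LinearOrder X] [OrderTop X] (φ : X → X) :
    ¬ MovesRight φ ((⊤ : X), (1 : ℤˣ)) := by
  simp [MovesRight, MovesInward, side_one, show (1 : ℤˣ) ≠ -1 by decide]

theorem movesRight_bot [LinearOrder X] [OrderBot X] (φ : X → X) :
    MovesRight φ ((⊥ : X), (-1 : ℤˣ)) := by
  simp [MovesRight, MovesInward, side_neg_one, bot_lt_iff_ne_bot, em']

theorem eventually_side_ne_of_finite_fixedPoints [LinearOrder X] [T1Space X] {φ : X → X}
    (hfin : (Function.fixedPoints φ).Finite) (g : Germ X) : ∀ᶠ y in side g, φ y ≠ y := by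
  have hnear : (Function.fixedPoints φ \ {g.1})ᶜ ∈ 𝓝 g.1 :=
    hfin.sdiff.isClosed.isOpen_compl.mem_nhds (by simp)
  filter_upwards [side_le_nhds g hnear, eventually_side_ne g] with y hy hyne hfix
  exact hy ⟨hfix, hyne⟩

theorem isStep_movesRight [ConditionallyCompleteLinearOrder X] [DenselyOrdered X]
    [OrderTopology X] {φ : X → X} (hφ : Continuous φ) (hfin : (Function.fixedPoints φ).Finite) :
    IsStep (MovesRight φ) := by
  rintro ⟨x, σ⟩
  have hne := eventually_side_ne_of_finite_fixedPoints hfin (x, σ)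
  suffices h : ∀ᶠ y in side (x, σ), (y < φ y ↔ MovesRight φ (x, σ)) by
    filter_upwards [h, hne] with y hy hyne τ
    rw [movesRight_iff_of_ne hyne, hy]
  rcases lt_trichotomy x (φ x) with hx | hx | hx
  · filter_upwards [side_le_nhds (x, σ) ((isOpen_lt continuous_id hφ).mem_nhds hx)] with y hy
    exact iff_of_true hy (Or.inl hx)
  · rw [movesRight_iff_of_eq hx.symm]
    by_cases hin : MovesInward φ (x, σ)
    · filter_upwards [hin] with y hy
      rcases Int.units_eq_one_or σ with rfl | rfl
      · simpa [hin, show (1 : ℤˣ) ≠ -1 by decide] using (dirLT_one.1 hy).le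
      · simpa [hin] using dirLT_neg_one.1 hy
    · filter_upwards [(eventually_side_dirLT_or hφ hne σ).resolve_left hin] with y hy
      rcases Int.units_eq_one_or σ with rfl | rfl
      · simpa [hin, show (1 : ℤˣ) ≠ -1 by decide] using dirLT_one.1 hy
      · simpa [hin] using (dirLT_neg_one.1 hy).le
  · filter_upwards [side_le_nhds (x, σ) ((isOpen_lt hφ continuous_id).mem_nhds hx)] with y hy
    exact iff_of_false (lt_asymm hy) fun h => h.elim hx.asymm fun h => hx.ne h.1

end MovesRight

section Counting

variable {X : Type*}

theorem iterSign_of_fixed [LinearOrder X] {f : X → X} {c : X} {ω : ℤˣ} {n : ℕ} {g : Germ X}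
    (h : (germMap f c ω)^[n] g = g) : iterSign f c ω n g = 1 := by
  rw [iterSign, h, Int.units_mul_self]

theorem iterSign_of_not_fixed [LinearOrder X] {f : X → X} {c : X} {ω : ℤˣ} {n : ℕ} {g : Germ X}
    (hx : f^[n] g.1 = g.1) (hg : (germMap f c ω)^[n] g ≠ g) : iterSign f c ω n g = -1 := by
  refine (Int.units_eq_one_or _).resolve_left fun h => hg ?_
  rw [germMap_iterate_eq, h, mul_one, hx]

theorem iterSign_sub_iterSign_of_not_mem_hitSet [LinearOrder X] {f : X → X} {c : X} {ω : ℤˣ}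
    {n : ℕ} {u : X} (hu : u ∉ hitSet f c n) :
    (iterSign f c ω n (u, 1) : ℤ) - iterSign f c ω n (u, -1) = 0 := by
  rw [iterSign_eq_of_not_hit (fun j hj h => hu ⟨j, hj, h⟩) 1 (-1), sub_self]

variable [TopologicalSpace X]

/-- The germs that are fixed by `f^n` and attracting. -/
def attractingGerms [LinearOrder X] (f : X → X) (c : X) (ω : ℤˣ) (n : ℕ) : Set (Germ X) :=
  {g | (germMap f c ω)^[n] g = g ∧ MovesInward f^[n] g}

open Classical in
/-- The direction of `f^n` along those germs near which `f^n` moves points to the right, and `0`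
along the other germs. -/
noncomputable def risingSign [LinearOrder X] (f : X → X) (c : X) (ω : ℤˣ) (n : ℕ) (g : Germ X) :
    ℤ :=
  if MovesRight f^[n] g then iterSign f c ω n g else 0

open Classical in
theorem sum_ite_attractingGerms [LinearOrder X] {f : X → X} {c : X} {ω : ℤˣ} {n : ℕ}
    (hfin : (Function.fixedPoints f^[n]).Finite) :
    ∑ u ∈ hfin.toFinset, ((if (u, 1) ∈ attractingGerms f c ω n then (1 : ℤ) else 0) +
      if (u, -1) ∈ attractingGerms f c ω n then 1 else 0) = (attractingGerms f c ω n).ncard := by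
  have hcoe : (hfin.toFinset ×ˢ ({1, -1} : Finset ℤˣ)).filter (· ∈ attractingGerms f c ω n) =
      attractingGerms f c ω n := by
    ext ⟨u, σ⟩
    simp only [Finset.coe_filter, Finset.mem_product, Set.Finite.mem_toFinset, Set.mem_ofPred_eq,
      Finset.mem_insert, Finset.mem_singleton, and_iff_right_iff_imp]
    intro hg
    have hu := congrArg Prod.fst hg.1
    rw [germMap_iterate_fst] at hu
    exact ⟨hu, Int.units_eq_one_or σ⟩
  rw [← congrArg Set.ncard hcoe, Set.ncard_coe_finset, ← Finset.sum_boole, Finset.sum_product]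
  refine Finset.sum_congr rfl fun u _ => ?_
  rw [Finset.sum_pair (by decide)]

theorem IsTurning.movesInward_of_not_fixed [LinearOrder X] [OrderTopology X] {f : X → X} {c : X}
    {ω : ℤˣ} (hf : IsTurning f c ω) {n : ℕ} {g : Germ X} (hx : f^[n] g.1 = g.1)
    (hg : (germMap f c ω)^[n] g ≠ g) : MovesInward f^[n] g := by
  have hside := (hf.tendsto_side_iterate n g).eventually (eventually_side_dirLT _)
  rw [germMap_iterate_eq, iterSign_of_not_fixed hx hg, hx, mul_neg_one] at hside
  filter_upwards [hside, eventually_side_dirLT g] with y hfy hy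
  exact (dirLT_neg.1 hfy).trans hy

open Classical in
theorem IsTurning.two_mul_risingSign [LinearOrder X] [OrderTopology X] {f : X → X} {c : X}
    {ω : ℤˣ} (hf : IsTurning f c ω) {n : ℕ} {g : Germ X} (hx : f^[n] g.1 = g.1) :
    2 * risingSign f c ω n g =
      g.2 + iterSign f c ω n g - 2 * g.2 * if g ∈ attractingGerms f c ω n then 1 else 0 := by
  rw [risingSign, movesRight_iff_of_eq hx]
  obtain ⟨x, σ⟩ := g
  by_cases hg : (germMap f c ω)^[n] (x, σ) = (x, σ)
  · rw [iterSign_of_fixed hg]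
    by_cases hin : MovesInward f^[n] (x, σ) <;> rcases Int.units_eq_one_or σ with rfl | rfl <;>
      simp [attractingGerms, hg, hin, show (1 : ℤˣ) ≠ -1 by decide]
  · rw [iterSign_of_not_fixed hx hg]
    rcases Int.units_eq_one_or σ with rfl | rfl <;>
      simp [attractingGerms, hg, hf.movesInward_of_not_fixed hx hg,
        show (1 : ℤˣ) ≠ -1 by decide]

open Classical in
theorem IsTurning.risingSign_sub_risingSign [LinearOrder X] [OrderTopology X] {f : X → X} {c : X}
    {ω : ℤˣ} (hf : IsTurning f c ω) (n : ℕ) (u : X) :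
    risingSign f c ω n (u, 1) - risingSign f c ω n (u, -1) =
      (if Before u ((germMap f c ω)^[n] (u, 1)) then
        (iterSign f c ω n (u, 1) : ℤ) - iterSign f c ω n (u, -1) else 0) +
      if f^[n] u = u then 1 - ((if (u, 1) ∈ attractingGerms f c ω n then (1 : ℤ) else 0) +
        if (u, -1) ∈ attractingGerms f c ω n then 1 else 0) - if u ∈ hitSet f c n then 1 else 0
      else 0 := by
  by_cases hu : f^[n] u = u
  · have hright := hf.two_mul_risingSign (g := (u, 1)) hu
    have hleft := hf.two_mul_risingSign (g := (u, -1)) hu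
    have hjump : (iterSign f c ω n (u, 1) : ℤ) - iterSign f c ω n (u, -1) =
        2 * (if Before u ((germMap f c ω)^[n] (u, 1)) then
          (iterSign f c ω n (u, 1) : ℤ) - iterSign f c ω n (u, -1) else 0) -
        2 * if u ∈ hitSet f c n then 1 else 0 := by
      by_cases hhit : u ∈ hitSet f c n
      · have ⟨i, hi, hc⟩ := hhit
        rw [germMap_iterate_eq, hu, iterSign_eq_of_hit hc hi 1, iterSign_eq_of_hit hc hi (-1)]
        rcases Int.units_eq_one_or (iterSign f c ω (n - i) (c, -1)) with h | h <;>
          simp [h, hhit, before_one, before_neg_one]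
      · simp [iterSign_sub_iterSign_of_not_mem_hitSet hhit, hhit]
    rw [if_pos hu]
    simp only [Units.val_one, Units.val_neg] at hright hleft
    linarith
  · rw [if_neg hu, germMap_iterate_eq, before_iff_lt_of_ne (Ne.symm hu), risingSign, risingSign,
      movesRight_iff_of_ne hu, movesRight_iff_of_ne hu, add_zero]
    split_ifs <;> simp

theorem IsTurning.ncard_fixedPoints [ConditionallyCompleteLinearOrder X] [DenselyOrdered X]
    [BoundedOrder X] [OrderTopology X] {f : X → X} {c : X} {ω : ℤˣ} (hf : IsTurning f c ω) {n : ℕ}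
    (hfin : (Function.fixedPoints f^[n]).Finite) :
    ((Function.fixedPoints f^[n]).ncard : ℤ) = (attractingGerms f c ω n).ncard +
      (Function.fixedPoints f^[n] ∩ hitSet f c n).ncard +
      2 * ∑ i ∈ Finset.range n, (iterSign f c ω (n - i) (c, -1) : ℤ) *
        hitCount f c i ((germMap f c ω)^[n - i] (c, -1)) - iterSign f c ω n (⊥, -1) := by
  classical
  have hstep : IsStep (risingSign f c ω n) :=
    (isStep_movesRight (hf.continuous.iterate n) hfin).map₂ (hf.isStep_iterSign n)
      fun p σ => if p then (σ : ℤ) else 0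
  have hhit := hf.finite_hitSet n
  have hsum := hstep.sub_eq_sum (hhit.toFinset ∪ hfin.toFinset) (fun u hu => ?_) (⊤, 1)
  · simp only [before_one, le_top, if_true, hf.risingSign_sub_risingSign,
      Finset.sum_add_distrib] at hsum
    have hkneading := hf.sum_hitSet_jump n (cut := fun u => (germMap f c ω)^[n] (u, 1))
      (γ := fun i => (germMap f c ω)^[n - i] (c, -1))
      fun i hi u hu => germMap_iterate_eq_of_hit hu.1 hi 1 (-1)
    have hturning : ∑ u ∈ hfin.toFinset, (if u ∈ hitSet f c n then (1 : ℤ) else 0) =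
        (Function.fixedPoints f^[n] ∩ hitSet f c n).ncard := by
      rw [Finset.sum_boole, ← Set.ncard_coe_finset, Finset.coe_filter]
      simp only [Set.Finite.mem_toFinset]
      rfl
    rw [← Finset.sum_subset Finset.subset_union_left fun u _ hu => ?_, hkneading,
      ← Finset.sum_subset Finset.subset_union_right fun u _ hu => ?_,
      Finset.sum_congr rfl fun u hu => if_pos (show f^[n] u = u from hfin.mem_toFinset.1 hu),
      Finset.sum_sub_distrib,
      Finset.sum_sub_distrib, sum_ite_attractingGerms hfin, hturning, Finset.sum_const,
      ← Set.ncard_eq_toFinset_card _ hfin, risingSign, if_neg (not_movesRight_top _), risingSign,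
      if_pos (movesRight_bot _), nsmul_one] at hsum
    · linarith
    · exact if_neg fun h => hu (hfin.mem_toFinset.2 h)
    · rw [iterSign_sub_iterSign_of_not_mem_hitSet fun h => hu (hhit.mem_toFinset.2 h), ite_self]
  · rw [Finset.mem_union, not_or, Set.Finite.mem_toFinset, Set.Finite.mem_toFinset] at hu
    rw [← sub_eq_zero, hf.risingSign_sub_risingSign, if_neg (show ¬ f^[n] u = u from hu.2),
      iterSign_sub_iterSign_of_not_mem_hitSet hu.1, ite_self, add_zero]

end Counting

/-! ### The finite sets of attracting germs and of periodic points over the turning point -/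

section Attracting

theorem eventually_dirLT_iterate {X : Type*} [Preorder X] {φ : X → X} {l : Filter X} {σ : ℤˣ}
    (hφ : Tendsto φ l l) (h : ∀ᶠ y in l, DirLT σ (φ y) y) {k : ℕ} (hk : 1 ≤ k) :
    ∀ᶠ y in l, DirLT σ (φ^[k] y) y := by
  induction k, hk using Nat.le_induction with
  | base => exact h
  | succ k _ ih =>
    filter_upwards [h, hφ.eventually ih] with y hy hiter
    exact hiter.trans hy

theorem movesInward_iterate_iff {X : Type*} [ConditionallyCompleteLinearOrder X]
    [TopologicalSpace X] [OrderTopology X] [DenselyOrdered X] {φ : X → X} (hφ : Continuous φ)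
    {g : Germ X} (hside : Tendsto φ (side g) (side g)) (hne : ∀ᶠ y in side g, φ y ≠ y) {k : ℕ}
    (hk : 1 ≤ k) : MovesInward φ^[k] g ↔ MovesInward φ g := by
  refine ⟨fun h => (eventually_side_dirLT_or hφ hne g.2).elim id fun hout => ?_,
    fun h => eventually_dirLT_iterate hside h hk⟩
  filter_upwards [h, eventually_dirLT_iterate hside (hout.mono fun y hy => dirLT_neg.2 hy) hk]
    with y hy hy'
  exact absurd hy (dirLT_neg.1 hy').asymm

variable {X : Type*} [TopologicalSpace X] {f : X → X} {c : X} {ω : ℤˣ}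

/-- The germs that are attracting for some iterate of `f`. -/
def allAttractingGerms [LinearOrder X] (f : X → X) (c : X) (ω : ℤˣ) : Set (Germ X) :=
  {g | ∃ n, 1 ≤ n ∧ g ∈ attractingGerms f c ω n}

theorem allAttractingGerms_subset_periodicPts [LinearOrder X] :
    allAttractingGerms f c ω ⊆ Function.periodicPts (germMap f c ω) := by
  rintro g ⟨n, hn, hg, -⟩
  exact ⟨n, hn, hg⟩

theorem IsTurning.tendsto_side_of_fixed [LinearOrder X] [OrderTopology X] (hf : IsTurning f c ω)
    {n : ℕ} {g : Germ X} (h : (germMap f c ω)^[n] g = g) : Tendsto f^[n] (side g) (side g) := by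
  simpa only [h] using hf.tendsto_side_iterate n g

theorem IsTurning.finite_allAttractingGerms [LinearOrder X] [OrderTopology X] [DenselyOrdered X]
    [BoundedOrder X] (hf : IsTurning f c ω)
    (hrep : {x ∈ Function.periodicPts f | ¬ IsRepelling f x}.Finite) :
    (allAttractingGerms f c ω).Finite := by
  refine ((hrep.union (Set.toFinite {⊥, ⊤})).prod (Set.finite_univ (α := ℤˣ))).subset ?_
  rintro ⟨x, σ⟩ ⟨n, hn, hg, hin⟩
  refine ⟨or_iff_not_imp_right.2 fun hx => ?_, Set.mem_univ _⟩
  have hfix : f^[n] x = x := by rw [← germMap_iterate_fst (c := c) (ω := ω) n (x, σ), hg]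
  have hne : (side (x, σ)).NeBot := by
    simp only [Set.mem_insert_iff, Set.mem_singleton_iff, not_or] at hx
    refine side_neBot ?_
    rcases Int.units_eq_one_or σ with rfl | rfl
    · exact ⟨⊤, dirLT_one.2 (lt_top_iff_ne_top.2 hx.2)⟩
    · exact ⟨⊥, dirLT_neg_one.2 (bot_lt_iff_ne_bot.2 hx.1)⟩
  exact ⟨⟨n, hn, hfix⟩, fun hr =>
    hr.not_movesInward hf.continuous hn hfix (hf.tendsto_side_of_fixed hg) hin⟩

variable [ConditionallyCompleteLinearOrder X] [OrderTopology X] [DenselyOrdered X]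

theorem IsTurning.mem_attractingGerms_of_iterate_mem (hf : IsTurning f c ω) {m n : ℕ}
    (hfin : (Function.fixedPoints f^[n]).Finite) {g : Germ X} (hg : (germMap f c ω)^[n] g = g)
    (h : (germMap f c ω)^[m] g ∈ attractingGerms f c ω n) : g ∈ attractingGerms f c ω n := by
  refine ⟨hg, (eventually_side_dirLT_or (hf.continuous.iterate n)
    (eventually_side_ne_of_finite_fixedPoints hfin g) g.2).elim id fun hout => ?_⟩
  have hpair : Tendsto (fun y => (y, f^[n] y)) (side g) (side g ×ˢ side g) :=
    tendsto_id.prodMk (hf.tendsto_side_of_fixed hg)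
  filter_upwards [hout, hpair.eventually (hf.eventually_dirLT_iterate m g),
    (hf.tendsto_side_iterate m g).eventually h.2] with y hy hmono hin
  have hcomm : f^[m] (f^[n] y) = f^[n] (f^[m] y) := Function.Commute.iterate_iterate_self f m n y
  exact absurd hin (hcomm ▸ hmono hy).asymm

theorem IsTurning.mapsTo_allAttractingGerms (hf : IsTurning f c ω)
    (hfin : ∀ n, 1 ≤ n → (Function.fixedPoints f^[n]).Finite) :
    Set.MapsTo (germMap f c ω) (allAttractingGerms f c ω) (allAttractingGerms f c ω) := by
  rintro g ⟨n, hn, hg⟩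
  refine ⟨n, hn, hf.mem_attractingGerms_of_iterate_mem (m := n - 1) (hfin n hn)
    (Function.IsPeriodicPt.apply hg.1) ?_⟩
  rwa [← Function.iterate_succ_apply, Nat.succ_eq_add_one, Nat.sub_add_cancel hn, hg.1]

theorem IsTurning.attractingGerms_eq (hf : IsTurning f c ω)
    (hfin : ∀ n, 1 ≤ n → (Function.fixedPoints f^[n]).Finite) {n : ℕ} (hn : 1 ≤ n) :
    attractingGerms f c ω n = {g ∈ allAttractingGerms f c ω | (germMap f c ω)^[n] g = g} := by
  refine Set.Subset.antisymm (fun g hg => ⟨⟨n, hn, hg⟩, hg.1⟩) ?_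
  rintro g ⟨⟨m, hm, hgm, hin⟩, hgn⟩
  have hiff {k l : ℕ} (hk : 1 ≤ k) (hl : 1 ≤ l) (hg : (germMap f c ω)^[k] g = g) :
      MovesInward f^[k * l] g ↔ MovesInward f^[k] g := by
    rw [Function.iterate_mul]
    exact movesInward_iterate_iff (hf.continuous.iterate k) (hf.tendsto_side_of_fixed hg)
      (eventually_side_ne_of_finite_fixedPoints (hfin k hk) g) hl
  exact ⟨hgn, by rwa [← hiff hn hm hgn, mul_comm, hiff hm hn hgm]⟩

end Attracting

section TurningOrbit

variable {X : Type*} {f : X → X} {c : X}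

/-- The periodic points whose orbit contains `c`. -/
def turningOrbit (f : X → X) (c : X) : Set X := {u ∈ Function.periodicPts f | ∃ i, f^[i] u = c}

theorem mapsTo_turningOrbit : Set.MapsTo f (turningOrbit f c) (turningOrbit f c) := by
  rintro u ⟨⟨p, hp, hpu⟩, i, hi⟩
  refine ⟨⟨p, hp, hpu.apply⟩, i + (p - 1), ?_⟩
  rw [← Function.iterate_succ_apply, Nat.succ_eq_add_one, add_assoc, Nat.sub_add_cancel hp,
    Function.iterate_add_apply, hpu.eq, hi]

theorem finite_turningOrbit : (turningOrbit f c).Finite := by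
  rcases (turningOrbit f c).eq_empty_or_nonempty with hempty | ⟨v, ⟨p, hp, hpv⟩, j, hj⟩
  · rw [hempty]
    exact Set.finite_empty
  · have hpc : Function.IsPeriodicPt f p c := hj ▸ hpv.apply_iterate j
    refine ((Set.finite_Iio p).image fun k => f^[k] c).subset ?_
    rintro u ⟨⟨q, hq, hqu⟩, i, hi⟩
    have hback : f^[q * i - i] c = u := by
      rw [← hi, ← Function.iterate_add_apply, Nat.sub_add_cancel (Nat.le_mul_of_pos_left i hq)]
      exact hqu.mul_const i
    exact ⟨(q * i - i) % p, Nat.mod_lt _ hp, (hpc.iterate_mod_apply _).trans hback⟩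

theorem fixedPoints_inter_hitSet {n : ℕ} (hn : 1 ≤ n) :
    Function.fixedPoints f^[n] ∩ hitSet f c n = {u ∈ turningOrbit f c | f^[n] u = u} := by
  ext u
  constructor
  · rintro ⟨h, i, -, hi⟩
    exact ⟨⟨⟨n, hn, h⟩, i, hi⟩, h⟩
  · rintro ⟨⟨-, i, hi⟩, h⟩
    exact ⟨h, i % n, Nat.mod_lt _ hn, by rw [← hi, Function.IsPeriodicPt.iterate_mod_apply h]⟩

end TurningOrbit

/-! ### The zeta function of a permutation of a finite set -/

section Orbits

variable {α : Type*} {T : α → α} {A : Set α} {g : α}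

theorem ncard_range_iterate (hg : g ∈ Function.periodicPts T) :
    (Set.range fun i => T^[i] g).ncard = Function.minimalPeriod T g := by
  have himage : (Set.range fun i => T^[i] g) =
      (fun i => T^[i] g) '' Set.Iio (Function.minimalPeriod T g) := by
    refine (Set.range_subset_iff.2 fun i => ?_).antisymm (Set.image_subset_range _ _)
    exact ⟨i % Function.minimalPeriod T g,
      Nat.mod_lt _ (Function.minimalPeriod_pos_of_mem_periodicPts hg),
      Function.iterate_mod_minimalPeriod_eq⟩
  rw [himage, Set.InjOn.ncard_image Function.iterate_injOn_Iio_minimalPeriod, ← Finset.coe_Iio,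
    Set.ncard_coe_finset, Nat.card_Iio]

theorem ncard_fixed_range_iterate (hg : g ∈ Function.periodicPts T) (n : ℕ) :
    {x ∈ Set.range fun i => T^[i] g | T^[n] x = x}.ncard =
      if Function.minimalPeriod T g ∣ n then Function.minimalPeriod T g else 0 := by
  have hfix : ∀ x ∈ Set.range fun i => T^[i] g,
      (T^[n] x = x ↔ Function.minimalPeriod T g ∣ n) := by
    rintro _ ⟨i, rfl⟩
    rw [← Function.minimalPeriod_apply_iterate hg i]
    exact Function.isPeriodicPt_iff_minimalPeriod_dvd
  split_ifs with hdvd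
  · rw [Set.sep_eq_self_iff_mem_true.2 fun x hx => (hfix x hx).2 hdvd, ncard_range_iterate hg]
  · rw [Set.sep_eq_empty_iff_mem_false.2 fun x hx => mt (hfix x hx).1 hdvd, Set.ncard_empty]

theorem mapsTo_sdiff_range_iterate (hT : Set.MapsTo T A A) (hA : A ⊆ Function.periodicPts T) :
    Set.MapsTo T (A \ Set.range fun i => T^[i] g) (A \ Set.range fun i => T^[i] g) := by
  rintro x ⟨hx, hxg⟩
  refine ⟨hT hx, ?_⟩
  rintro ⟨i, hi : T^[i] g = T x⟩
  obtain ⟨p, hp, hpx⟩ := hA hx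
  refine hxg ⟨p - 1 + i, ?_⟩
  dsimp only
  rw [Function.iterate_add_apply, hi, ← Function.iterate_succ_apply, Nat.succ_eq_add_one,
    Nat.sub_add_cancel hp]
  exact hpx

theorem ncard_fixed_eq_add (hA : A.Finite) {O : Set α} (hO : O ⊆ A) (n : ℕ) :
    {x ∈ A | T^[n] x = x}.ncard =
      {x ∈ A \ O | T^[n] x = x}.ncard + {x ∈ O | T^[n] x = x}.ncard := by
  rw [← Set.ncard_inter_add_ncard_sdiff_eq_ncard _ O (hA.subset (Set.sep_subset A _)), add_comm]
  congr 2
  · ext x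
    exact and_right_comm
  · ext x
    exact ⟨fun h => ⟨h.2, h.1.2⟩, fun h => ⟨⟨hO h.1, h.2⟩, h.1⟩⟩

end Orbits

section FiniteZeta

open PowerSeries

/-- The series `∑_{n ≥ 1} N_n t^n`. -/
noncomputable def countSeries (N : ℕ → ℕ) : PowerSeries ℚ :=
  PowerSeries.mk fun n => if n = 0 then 0 else (N n : ℚ)

theorem countSeries_add (M N : ℕ → ℕ) :
    countSeries (fun n => M n + N n) = countSeries M + countSeries N := by
  ext n
  simp only [countSeries, map_add, coeff_mk, Nat.cast_add]
  split_ifs <;> ring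

theorem countSeries_congr {M N : ℕ → ℕ} (h : ∀ n, 1 ≤ n → M n = N n) :
    countSeries M = countSeries N := by
  ext n
  simp only [countSeries, coeff_mk]
  split_ifs with hn
  · rfl
  · rw [h n (Nat.one_le_iff_ne_zero.2 hn)]

theorem one_sub_X_pow_mul_countSeries {p : ℕ} (hp : 0 < p) :
    (1 - X ^ p) * countSeries (fun n => if p ∣ n then p else 0) =
      -(X * d⁄dX ℚ ((1 : PowerSeries ℚ) - X ^ p)) := by
  have hderiv : -(X * d⁄dX ℚ ((1 : PowerSeries ℚ) - X ^ p)) = (p : ℚ) • X ^ p := by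
    obtain ⟨q, rfl⟩ := Nat.exists_eq_add_of_le' hp
    rw [map_sub, derivative_one, derivative_pow, derivative_X, PowerSeries.smul_eq_C_mul,
      map_natCast, Nat.add_sub_cancel]
    ring
  rw [hderiv]
  ext n
  rw [sub_mul, one_mul, map_sub, coeff_X_pow_mul', coeff_smul, coeff_X_pow]
  simp only [countSeries, coeff_mk]
  rcases Nat.eq_zero_or_pos n with rfl | hn
  · simp [hp.ne', hp.ne]
  rw [if_neg hn.ne']
  by_cases hpn : p ≤ n
  · obtain ⟨m, rfl⟩ := Nat.exists_eq_add_of_le hpn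
    rcases Nat.eq_zero_or_pos m with rfl | hm
    · simp
    · simp [hm.ne']
  · rw [if_neg hpn, if_neg fun hdvd => hpn (Nat.le_of_dvd hn hdvd), if_neg fun h => hpn h.ge]
    simp

theorem exists_zeta_polynomial {α : Type*} {T : α → α} {A : Set α} (hfin : A.Finite)
    (hT : Set.MapsTo T A A) (hA : A ⊆ Function.periodicPts T) :
    ∃ Z : Polynomial ℚ, Z.coeff 0 = 1 ∧
      (Z : PowerSeries ℚ) * countSeries (fun n => {x ∈ A | T^[n] x = x}.ncard) =
        -(X * d⁄dX ℚ (Z : PowerSeries ℚ)) := by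
  induction hk : A.ncard using Nat.strong_induction_on generalizing A with
  | _ k ih =>
  subst hk
  rcases A.eq_empty_or_nonempty with rfl | ⟨g, hg⟩
  · refine ⟨1, Polynomial.coeff_one_zero, ?_⟩
    ext n
    simp [countSeries]
  set p := Function.minimalPeriod T g
  have hp : 0 < p := Function.minimalPeriod_pos_of_mem_periodicPts (hA hg)
  set O : Set α := Set.range fun i => T^[i] g
  have hOA : O ⊆ A := Set.range_subset_iff.2 fun i => hT.iterate i hg
  have hlt : (A \ O).ncard < A.ncard :=
    Set.ncard_lt_ncard ⟨Set.sdiff_subset, fun h => (h hg).2 ⟨0, rfl⟩⟩ hfin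
  obtain ⟨Z, hZ0, hZ⟩ := ih _ hlt hfin.sdiff (mapsTo_sdiff_range_iterate hT hA)
    (Set.sdiff_subset.trans hA) rfl
  refine ⟨Z * (1 - Polynomial.X ^ p), by simp [Polynomial.mul_coeff_zero, hZ0, hp.ne], ?_⟩
  have hsplit : countSeries (fun n => {x ∈ A | T^[n] x = x}.ncard) =
      countSeries (fun n => {x ∈ A \ O | T^[n] x = x}.ncard) +
        countSeries (fun n => if p ∣ n then p else 0) := by
    simp only [ncard_fixed_eq_add hfin hOA, countSeries_add, O, ncard_fixed_range_iterate (hA hg)]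
    rfl
  push_cast
  rw [hsplit, Derivation.leibniz, smul_eq_mul, smul_eq_mul]
  linear_combination (1 - X ^ p : PowerSeries ℚ) * hZ +
    (Z : PowerSeries ℚ) * one_sub_X_pow_mul_countSeries hp

end FiniteZeta

/-! ### The kneading series -/

section ShiftedSum

open PowerSeries
open Finset.HasAntidiagonal (antidiagonal mem_antidiagonal)

variable {R : Type*}

/-- The sum `∑_j t^j P_j` of a sequence of power series. -/
noncomputable def shiftedSum [Semiring R] (P : ℕ → PowerSeries R) : PowerSeries R :=
  PowerSeries.mk fun n => ∑ ij ∈ antidiagonal n, coeff ij.2 (P ij.1)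

theorem shiftedSum_sub [Ring R] (P Q : ℕ → PowerSeries R) :
    shiftedSum (fun j => P j - Q j) = shiftedSum P - shiftedSum Q := by
  ext n
  simp only [shiftedSum, coeff_mk, map_sub, Finset.sum_sub_distrib]

theorem shiftedSum_coeff_smul [Semiring R] (P Q : PowerSeries R) :
    shiftedSum (fun j => coeff j P • Q) = P * Q := by
  ext n
  simp only [shiftedSum, coeff_mk, coeff_smul, smul_eq_mul, coeff_mul]

theorem mul_shiftedSum [Semiring R] (Q : PowerSeries R) (P : ℕ → PowerSeries R) :
    Q * shiftedSum P = shiftedSum fun j => Q * P j := by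
  ext n
  simp only [shiftedSum, coeff_mul, coeff_mk, Finset.mul_sum]
  rw [Finset.sum_sigma', Finset.sum_sigma']
  refine Finset.sum_nbij' (fun x => ⟨(x.2.1, x.1.1 + x.2.2), (x.1.1, x.2.2)⟩)
    (fun x => ⟨(x.2.1, x.1.1 + x.2.2), (x.1.1, x.2.2)⟩) ?_ ?_ ?_ ?_ fun _ _ => rfl
  all_goals
    rintro ⟨⟨a, b⟩, ⟨j, i⟩⟩ h
    simp only [Finset.mem_sigma, mem_antidiagonal] at h ⊢
    grind

end ShiftedSum

section KneadingSeries

open PowerSeries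
open Finset.HasAntidiagonal (antidiagonal mem_antidiagonal)

variable {X : Type*} [LinearOrder X] {f : X → X} {c : X} {ω : ℤˣ}

/-- The kneading series of `f`: its coefficients are the directions of the iterates of `f` on the
left of the turning point. The `n`-th coefficient belongs to the iterate `f^(n+1)`. -/
noncomputable def kneadingSeries (f : X → X) (c : X) (ω : ℤˣ) : PowerSeries ℚ :=
  PowerSeries.mk fun n => ((iterSign f c ω (n + 1) (c, -1) : ℤ) : ℚ)

/-- The series of directions of the iterates of `f` along a germ. -/
noncomputable def signSeries (f : X → X) (c : X) (ω : ℤˣ) (g : Germ X) : PowerSeries ℚ :=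
  PowerSeries.mk fun n => ((iterSign f c ω n g : ℤ) : ℚ)

/-- The series of numbers of preimages of the turning point before a germ. -/
noncomputable def hitSeries (f : X → X) (c : X) (g : Germ X) : PowerSeries ℚ :=
  PowerSeries.mk fun n => (hitCount f c n g : ℚ)

/-- The series `∑_j t^j D_j H_j`, where `D_j` is the `j`-th coefficient of the kneading series and
`H_j` the hit series of the `j`-th germ on the orbit of the turning value. -/
noncomputable def kneadingHitSeries (f : X → X) (c : X) (ω : ℤˣ) : PowerSeries ℚ :=
  shiftedSum fun j =>
    coeff j (kneadingSeries f c ω) • hitSeries f c ((germMap f c ω)^[j + 1] (c, -1))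

theorem shiftedSum_coeff_kneadingSeries_smul_signSeries :
    shiftedSum (fun j => coeff j (kneadingSeries f c ω) •
      signSeries f c ω ((germMap f c ω)^[j + 1] (c, -1))) =
      kneadingSeries f c ω + PowerSeries.X * d⁄dX ℚ (kneadingSeries f c ω) := by
  have hcoeff : ∀ n, ∀ ij ∈ antidiagonal n, coeff ij.2 (coeff ij.1 (kneadingSeries f c ω) •
      signSeries f c ω ((germMap f c ω)^[ij.1 + 1] (c, -1))) = coeff n (kneadingSeries f c ω) := by
    rintro _ ⟨i, j⟩ hij
    rw [← mem_antidiagonal.1 hij, coeff_smul, smul_eq_mul, kneadingSeries, signSeries,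
      coeff_mk, coeff_mk, coeff_mk, add_right_comm, iterSign_add (i + 1) j]
    push_cast
    rfl
  ext n
  rw [shiftedSum, coeff_mk, Finset.sum_congr rfl (hcoeff n), Finset.sum_const,
    Finset.Nat.card_antidiagonal, map_add]
  cases n with
  | zero => simp
  | succ n =>
    rw [coeff_succ_X_mul, coeff_derivative, nsmul_eq_mul]
    push_cast
    ring

variable [TopologicalSpace X] [OrderTopology X]

theorem IsTurning.signSeries_sub [PreconnectedSpace X] [OrderBot X] (hf : IsTurning f c ω)
    (g : Germ X) : signSeries f c ω g - signSeries f c ω (⊥, -1) =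
      -2 * (PowerSeries.X * (kneadingSeries f c ω * hitSeries f c g)) := by
  ext n
  have hidentity := congrArg (Int.cast : ℤ → ℚ) (hf.iterSign_sub_iterSign_bot n g)
  push_cast at hidentity
  rw [show (-2 : PowerSeries ℚ) = C (-2 : ℚ) by rw [map_neg, map_ofNat], coeff_C_mul]
  simp only [map_sub, signSeries, coeff_mk]
  rw [hidentity]
  cases n with
  | zero => simp
  | succ n =>
    rw [coeff_succ_X_mul, mul_comm (kneadingSeries _ _ _), coeff_mul]
    simp only [hitSeries, kneadingSeries, coeff_mk]
    rw [Finset.Nat.sum_antidiagonal_eq_sum_range_succ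
      (fun i j => (hitCount f c i g : ℚ) * ((iterSign f c ω (j + 1) (c, -1) : ℤ) : ℚ))]
    congr 1
    refine Finset.sum_congr rfl fun i hi => ?_
    rw [mul_comm, Nat.sub_add_comm (Finset.mem_range_succ_iff.1 hi)]

theorem IsTurning.kneadingSeries_mul_kneadingHitSeries [PreconnectedSpace X] [OrderBot X]
    (hf : IsTurning f c ω) :
    -2 * (PowerSeries.X * (kneadingSeries f c ω * kneadingHitSeries f c ω)) =
      kneadingSeries f c ω + PowerSeries.X * d⁄dX ℚ (kneadingSeries f c ω) -
        kneadingSeries f c ω * signSeries f c ω (⊥, -1) := by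
  have hterm : ∀ j, -2 * PowerSeries.X * kneadingSeries f c ω *
      (coeff j (kneadingSeries f c ω) • hitSeries f c ((germMap f c ω)^[j + 1] (c, -1))) =
        coeff j (kneadingSeries f c ω) • signSeries f c ω ((germMap f c ω)^[j + 1] (c, -1)) -
          coeff j (kneadingSeries f c ω) • signSeries f c ω (⊥, -1) := fun j => by
    rw [← smul_sub, hf.signSeries_sub, mul_smul_comm, mul_assoc, mul_assoc]
  rw [← mul_assoc, ← mul_assoc, kneadingHitSeries, mul_shiftedSum, funext hterm, shiftedSum_sub,
    shiftedSum_coeff_kneadingSeries_smul_signSeries, shiftedSum_coeff_smul]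

end KneadingSeries

section CountSeries

open PowerSeries

variable {X : Type*} [ConditionallyCompleteLinearOrder X] [TopologicalSpace X] [OrderTopology X]
  [DenselyOrdered X] [BoundedOrder X] {f : X → X} {c : X} {ω : ℤˣ}

theorem IsTurning.countSeries_fixedPoints (hf : IsTurning f c ω)
    (hfin : ∀ n, 1 ≤ n → (Function.fixedPoints f^[n]).Finite) :
    countSeries (fun n => (Function.fixedPoints f^[n]).ncard) =
      countSeries (fun n => {g ∈ allAttractingGerms f c ω | (germMap f c ω)^[n] g = g}.ncard) +
        countSeries (fun n => {u ∈ turningOrbit f c | f^[n] u = u}.ncard) +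
        2 * (PowerSeries.X * kneadingHitSeries f c ω) - signSeries f c ω (⊥, -1) + 1 := by
  ext n
  rw [show (2 : PowerSeries ℚ) = C (2 : ℚ) by rw [map_ofNat], map_add, map_sub, map_add, map_add,
    coeff_C_mul]
  simp only [countSeries, signSeries, coeff_mk]
  cases n with
  | zero => simp [iterSign_zero]
  | succ n =>
    have hcount := congrArg (Int.cast : ℤ → ℚ) (hf.ncard_fixedPoints (hfin (n + 1) n.succ_pos))
    rw [hf.attractingGerms_eq hfin n.succ_pos, fixedPoints_inter_hitSet n.succ_pos] at hcount
    push_cast at hcount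
    rw [if_neg n.succ_ne_zero, if_neg n.succ_ne_zero, if_neg n.succ_ne_zero, hcount,
      coeff_succ_X_mul, coeff_one, if_neg n.succ_ne_zero, add_zero, kneadingHitSeries, shiftedSum,
      coeff_mk, Finset.Nat.sum_antidiagonal_eq_sum_range_succ (fun j i => coeff i
        (coeff j (kneadingSeries f c ω) • hitSeries f c ((germMap f c ω)^[j + 1] (c, -1)))),
      ← Finset.sum_range_reflect]
    congr 3
    refine Finset.sum_congr rfl fun i hi => ?_
    have hi := Finset.mem_range_succ_iff.1 hi
    rw [coeff_smul, smul_eq_mul, kneadingSeries, hitSeries, coeff_mk, coeff_mk,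
      show n + 1 - (n + 1 - 1 - i) = i + 1 by omega, show n + 1 - 1 - i = n - i by omega]

theorem IsTurning.kneadingSeries_mul_countSeries (hf : IsTurning f c ω)
    (hfin : ∀ n, 1 ≤ n → (Function.fixedPoints f^[n]).Finite) :
    kneadingSeries f c ω * countSeries (fun n => (Function.fixedPoints f^[n]).ncard) =
      kneadingSeries f c ω *
          countSeries (fun n => {g ∈ allAttractingGerms f c ω | (germMap f c ω)^[n] g = g}.ncard) +
        kneadingSeries f c ω * countSeries (fun n => {u ∈ turningOrbit f c | f^[n] u = u}.ncard) -
        PowerSeries.X * d⁄dX ℚ (kneadingSeries f c ω) := by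
  rw [hf.countSeries_fixedPoints hfin]
  linear_combination -hf.kneadingSeries_mul_kneadingHitSeries

end CountSeries

/-! ### The zeta function and the kneading series -/

section Zeta

open PowerSeries

section Topological

variable {X : Type*} [TopologicalSpace X]

theorem isolatedFixedPts_eq_fixedPoints [T1Space X] {f : X → X} {n : ℕ}
    (hfin : (Function.fixedPoints f^[n]).Finite) :
    isolatedFixedPts f n = Function.fixedPoints f^[n] := by
  refine Set.Subset.antisymm (fun x hx => hx.1) fun x hx => ⟨hx,
    (Function.fixedPoints f^[n] \ {x})ᶜ, hfin.sdiff.isClosed.isOpen_compl, by simp,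
    fun y hy hfix => ?_⟩
  by_contra hne
  exact hy ⟨hfix, hne⟩

theorem X_mul_derivative_logZeta (f : X → X) :
    PowerSeries.X * d⁄dX ℚ (logZeta f) = countSeries fun n => (isolatedFixedPts f n).ncard := by
  ext n
  cases n with
  | zero => simp [countSeries]
  | succ n =>
    rw [coeff_succ_X_mul, coeff_derivative, logZeta, countSeries, coeff_mk, coeff_mk,
      if_neg n.succ_ne_zero, if_neg n.succ_ne_zero]
    push_cast
    field_simp

theorem derivative_artinMazurZeta (f : X → X) :
    d⁄dX ℚ (artinMazurZeta f) = artinMazurZeta f * d⁄dX ℚ (logZeta f) := by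
  rw [artinMazurZeta, derivative_subst (hasSubst_logZeta f), derivative_exp]

theorem constantCoeff_artinMazurZeta (f : X → X) : constantCoeff (artinMazurZeta f) = 1 := by
  have hlog : constantCoeff (logZeta f) = 0 := by
    rw [← coeff_zero_eq_constantCoeff_apply]
    simp [logZeta]
  have hsubst := constantCoeff_subst (hasSubst_logZeta f) (PowerSeries.exp ℚ)
  rw [finsum_eq_single _ 0 fun d hd => by
    rw [map_pow]
    change _ • (constantCoeff (logZeta f)) ^ d = 0
    rw [hlog, zero_pow hd, smul_zero]] at hsubst
  change MvPowerSeries.constantCoeff (artinMazurZeta f) = 1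
  rw [artinMazurZeta, hsubst]
  simp

end Topological

theorem eq_C_of_X_mul_derivative_eq_zero {R : Type*} [CommRing R] [IsAddTorsionFree R]
    {W : PowerSeries R} (h : X * d⁄dX R W = 0) : W = C (constantCoeff W) := by
  refine derivative.ext ?_ (by simp)
  rw [derivative_C]
  exact X_mul_cancel (by rw [h, mul_zero])

theorem IsRationalSeries.of_mul_eq_C {F G : PowerSeries ℚ} {Z : Polynomial ℚ} {u : ℚ} (hu : u ≠ 0)
    (h : F * G * (Z : PowerSeries ℚ) = C u) (hF : IsRationalSeries F) : IsRationalSeries G := by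
  obtain ⟨P, Q, hQ, hP⟩ := hF
  have hC : (C u : PowerSeries ℚ) ≠ 0 := (map_ne_zero_iff _ C_injective).2 hu
  have hF : F ≠ 0 := by
    rintro rfl
    exact hC (by rw [← h, zero_mul, zero_mul])
  have hZ : Z ≠ 0 := by
    rintro rfl
    exact hC (by rw [← h, Polynomial.coe_zero, mul_zero])
  have hP0 : P ≠ 0 := by
    rintro rfl
    have hQ' : (Q : PowerSeries ℚ) ≠ 0 := fun h => hQ (Polynomial.coe_eq_zero_iff.1 h)
    exact mul_ne_zero hQ' hF (by rw [hP, Polynomial.coe_zero])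
  refine ⟨Q * Polynomial.C u, P * Z, mul_ne_zero hP0 hZ, ?_⟩
  rw [Polynomial.coe_mul, Polynomial.coe_mul, Polynomial.coe_C, ← h, ← hP]
  ring

variable {X : Type*} [ConditionallyCompleteLinearOrder X] [TopologicalSpace X] [OrderTopology X]
  [DenselyOrdered X] [BoundedOrder X] {f : X → X} {c : X} {ω : ℤˣ}

theorem IsTurning.exists_artinMazurZeta_mul_kneadingSeries (hf : IsTurning f c ω)
    (hrep : {x ∈ Function.periodicPts f | ¬ IsRepelling f x}.Finite) :
    ∃ (Z : Polynomial ℚ) (u : ℚ), u ≠ 0 ∧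
      artinMazurZeta f * kneadingSeries f c ω * (Z : PowerSeries ℚ) = C u := by
  have hfin : ∀ n, 1 ≤ n → (Function.fixedPoints f^[n]).Finite :=
    fun n hn => hf.finite_fixedPoints hrep hn
  obtain ⟨Z₁, hZ₁0, hZ₁⟩ := exists_zeta_polynomial (hf.finite_allAttractingGerms hrep)
    (hf.mapsTo_allAttractingGerms hfin) allAttractingGerms_subset_periodicPts
  obtain ⟨Z₂, hZ₂0, hZ₂⟩ := exists_zeta_polynomial (finite_turningOrbit (f := f) (c := c))
    mapsTo_turningOrbit fun u hu => hu.1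
  have hlog : PowerSeries.X * d⁄dX ℚ (logZeta f) =
      countSeries fun n => (Function.fixedPoints f^[n]).ncard := by
    rw [X_mul_derivative_logZeta]
    exact countSeries_congr fun n hn => by rw [isolatedFixedPts_eq_fixedPoints (hfin n hn)]
  have hknead := hf.kneadingSeries_mul_countSeries hfin
  have hζ := derivative_artinMazurZeta f
  set D := kneadingSeries f c ω with hD
  set ζ := artinMazurZeta f
  refine ⟨Z₁ * Z₂, constantCoeff (ζ * D * ((Z₁ * Z₂ : Polynomial ℚ) : PowerSeries ℚ)), ?_,
    eq_C_of_X_mul_derivative_eq_zero ?_⟩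
  · have hD0 : constantCoeff D = ((iterSign f c ω 1 (c, -1) : ℤ) : ℚ) := by
      rw [← coeff_zero_eq_constantCoeff_apply, hD, kneadingSeries, coeff_mk]
    rw [map_mul, map_mul, constantCoeff_artinMazurZeta, hD0, Polynomial.constantCoeff_coe,
      Polynomial.mul_coeff_zero, hZ₁0, hZ₂0]
    simp
  · rw [Polynomial.coe_mul]
    simp only [Derivation.leibniz, smul_eq_mul, hζ]
    linear_combination (ζ * D * Z₁ * Z₂ : PowerSeries ℚ) * hlog +
      (ζ * Z₁ * Z₂ : PowerSeries ℚ) * hknead + (ζ * D * Z₂ : PowerSeries ℚ) * hZ₁ +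
      (ζ * D * Z₁ : PowerSeries ℚ) * hZ₂

theorem IsTurning.isRationalSeries_artinMazurZeta_iff (hf : IsTurning f c ω)
    (hrep : {x ∈ Function.periodicPts f | ¬ IsRepelling f x}.Finite) :
    IsRationalSeries (artinMazurZeta f) ↔ IsRationalSeries (kneadingSeries f c ω) := by
  obtain ⟨Z, u, hu, h⟩ := hf.exists_artinMazurZeta_mul_kneadingSeries hrep
  exact ⟨IsRationalSeries.of_mul_eq_C hu h,
    IsRationalSeries.of_mul_eq_C hu (by rwa [mul_comm (kneadingSeries f c ω)])⟩

end Zeta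

/-! ### Eventually periodic sequences -/

section EventuallyPeriodic

theorem eventually_atTop_of_forall_residue {p : ℕ} (hp : 0 < p) {P : ℕ → Prop}
    (h : ∀ r < p, ∀ᶠ k in atTop, P (k * p + r)) : ∀ᶠ n in atTop, P n := by
  have hall : ∀ᶠ k in atTop, ∀ r ∈ Finset.range p, P (k * p + r) :=
    (eventually_all_finset _).2 fun r hr => h r (Finset.mem_range.1 hr)
  filter_upwards [(Nat.tendsto_div_const_atTop hp.ne').eventually hall] with n hn
  simpa only [Nat.div_add_mod'] using hn (n % p) (Finset.mem_range.2 (n.mod_lt hp))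

/-- The sequence `a` is eventually periodic; the period need not be minimal. -/
def EventuallyPeriodic {α : Type*} (a : ℕ → α) : Prop :=
  ∃ p, 0 < p ∧ ∀ᶠ n in atTop, a (n + p) = a n

namespace EventuallyPeriodic

variable {α β : Type*} {a : ℕ → α}

theorem map (h : EventuallyPeriodic a) (φ : α → β) : EventuallyPeriodic fun n => φ (a n) := by
  obtain ⟨p, hp, hper⟩ := h
  exact ⟨p, hp, hper.mono fun n hn => congrArg φ hn⟩

theorem comp_add_iff (m : ℕ) : EventuallyPeriodic (fun n => a (n + m)) ↔ EventuallyPeriodic a := by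
  refine exists_congr fun p => and_congr_right fun _ => ?_
  conv_rhs => rw [← map_add_atTop_eq_nat m, eventually_map]
  simp only [add_right_comm _ p m]

theorem of_residues {p : ℕ} (hp : 0 < p)
    (h : ∀ r < p, ∃ b, ∀ᶠ k in atTop, a (k * p + r) = b) : EventuallyPeriodic a := by
  refine ⟨p, hp, eventually_atTop_of_forall_residue hp fun r hr => ?_⟩
  obtain ⟨b, hb⟩ := h r hr
  filter_upwards [hb, (tendsto_add_atTop_nat 1).eventually hb] with k hk hk'
  rw [hk, ← hk']
  congr 1
  ring

theorem of_finite_range (hfin : (Set.range a).Finite) (n₀ : ℕ)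
    (hnext : ∀ m ≥ n₀, ∀ n ≥ n₀, a m = a n → a (m + 1) = a (n + 1)) : EventuallyPeriodic a := by
  obtain ⟨m, hm, n, hn, hne, heq⟩ := (Set.Ici_infinite n₀).exists_ne_map_eq_of_mapsTo
    (fun n _ => Set.mem_range_self n) hfin
  wlog hlt : m < n generalizing m n
  · exact this n hn m hm hne.symm heq.symm (by omega)
  have hshift : ∀ k, a (m + k) = a (n + k) := fun k => by
    induction k with
    | zero => exact heq
    | succ k ih => exact hnext _ (le_add_right hm) _ (le_add_right hn) ih
  refine ⟨n - m, by omega, eventually_atTop.2 ⟨m, fun k hk => ?_⟩⟩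
  obtain ⟨k, rfl⟩ := Nat.exists_eq_add_of_le hk
  rw [hshift, show m + k + (n - m) = n + k by omega]

theorem of_recurrence (hfin : (Set.range a).Finite) (d n₀ : ℕ)
    (hrec : ∀ m ≥ n₀, ∀ n ≥ n₀, (∀ i < d, a (m + i) = a (n + i)) → a (m + d) = a (n + d)) :
    EventuallyPeriodic a := by
  suffices h : EventuallyPeriodic fun n (i : Fin (d + 1)) => a (n + i) by
    simpa using h.map fun w => w 0
  refine of_finite_range ((Set.Finite.pi' fun _ => hfin).subset ?_) n₀ fun m hm n hn heq => ?_
  · rintro _ ⟨n, rfl⟩ i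
    exact Set.mem_range_self _
  · have hwindow : ∀ i < d, a (m + 1 + i) = a (n + 1 + i) := fun i hi => by
      simpa only [add_assoc, add_comm i 1] using congrFun heq ⟨i + 1, by omega⟩
    funext ⟨i, hi⟩
    rcases Nat.lt_succ_iff_lt_or_eq.1 hi with hi | rfl
    exacts [hwindow i hi, hrec _ (by omega) _ (by omega) hwindow]

theorem of_succ_eq_mul {θ δ : ℕ → ℤˣ} (hθ : ∀ n, θ (n + 1) = θ n * δ n)
    (hδ : EventuallyPeriodic δ) : EventuallyPeriodic θ := by
  obtain ⟨p, hp, hper⟩ := hδ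
  obtain ⟨n₀, hn₀⟩ := eventually_atTop.1 hper
  set η := θ (n₀ + p) * θ n₀ with hη
  have hshift : ∀ k, θ (n₀ + k + p) = η * θ (n₀ + k) := fun k => by
    induction k with
    | zero => rw [hη, add_zero, mul_assoc, Int.units_mul_self, mul_one]
    | succ k ih =>
      rw [← add_assoc, add_right_comm _ 1 p, hθ, hθ, ih, hn₀ _ (by omega), mul_assoc]
  refine ⟨p + p, by omega, eventually_atTop.2 ⟨n₀, fun n hn => ?_⟩⟩
  obtain ⟨k, rfl⟩ := Nat.exists_eq_add_of_le hn
  rw [← add_assoc, add_assoc n₀, hshift, ← add_assoc, hshift, ← mul_assoc, Int.units_mul_self,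
    one_mul]

theorem isRationalSeries {a : ℕ → ℚ} (h : EventuallyPeriodic a) :
    IsRationalSeries (PowerSeries.mk a) := by
  obtain ⟨p, hp, hper⟩ := h
  obtain ⟨n₀, hn₀⟩ := eventually_atTop.1 hper
  refine ⟨PowerSeries.trunc (n₀ + p) ((1 - PowerSeries.X ^ p) * PowerSeries.mk a),
    1 - Polynomial.X ^ p, fun h => ?_, ?_⟩
  · have := congrArg (Polynomial.coeff · 0) h
    simp [hp.ne] at this
  · ext n
    rw [Polynomial.coeff_coe, PowerSeries.coeff_trunc]
    push_cast
    split_ifs with hn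
    · rfl
    · obtain ⟨m, rfl⟩ : ∃ m, n = m + p := ⟨n - p, by omega⟩
      rw [sub_mul, one_mul, map_sub, PowerSeries.coeff_X_pow_mul, PowerSeries.coeff_mk,
        PowerSeries.coeff_mk, hn₀ m (by omega), sub_self]

end EventuallyPeriodic

theorem sum_coeff_mul_eq_zero {R : Type*} [CommRing R] {P Q : Polynomial R} {a : ℕ → R}
    (h : (Q : PowerSeries R) * PowerSeries.mk a = P) {n : ℕ} (hn : P.natDegree < n + Q.natDegree) :
    ∑ i ∈ Finset.range (Q.natDegree + 1), Q.coeff i * a (n + Q.natDegree - i) = 0 := by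
  have hcoeff := congrArg (PowerSeries.coeff (n + Q.natDegree)) h
  rw [Polynomial.coeff_coe, Polynomial.coeff_eq_zero_of_natDegree_lt hn, PowerSeries.coeff_mul,
    Finset.Nat.sum_antidiagonal_eq_sum_range_succ (fun i j =>
      PowerSeries.coeff i (Q : PowerSeries R) * PowerSeries.coeff j (PowerSeries.mk a))] at hcoeff
  simp only [Polynomial.coeff_coe, PowerSeries.coeff_mk] at hcoeff
  rw [← hcoeff]
  refine Finset.sum_subset (Finset.range_mono (by omega)) fun i _ hi => ?_
  rw [Polynomial.coeff_eq_zero_of_natDegree_lt (by simpa using hi), zero_mul]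

theorem IsRationalSeries.eventuallyPeriodic {a : ℕ → ℚ} (hfin : (Set.range a).Finite)
    (h : IsRationalSeries (PowerSeries.mk a)) : EventuallyPeriodic a := by
  obtain ⟨P, Q, hQ, hPQ⟩ := h
  set v := Q.natTrailingDegree
  have hv : v ≤ Q.natDegree := Q.natTrailingDegree_le_natDegree
  have hQv : Q.coeff v ≠ 0 := Polynomial.trailingCoeff_nonzero_iff_nonzero.2 hQ
  refine .of_recurrence hfin (Q.natDegree - v) (P.natDegree + 1) fun m hm n hn hwindow => ?_
  have hsum := (sum_coeff_mul_eq_zero hPQ (n := m) (by omega)).trans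
    (sum_coeff_mul_eq_zero hPQ (n := n) (by omega)).symm
  rw [← sub_eq_zero, ← Finset.sum_sub_distrib, Finset.sum_eq_single v] at hsum
  · rw [← mul_sub, mul_eq_zero_iff_left hQv, sub_eq_zero] at hsum
    simpa only [Nat.add_sub_assoc hv] using hsum
  · intro i hi hiv
    rcases hiv.lt_or_gt with hlt | hgt
    · rw [Polynomial.coeff_eq_zero_of_lt_natTrailingDegree hlt, zero_mul, zero_mul, sub_self]
    · have hi : i ≤ Q.natDegree := Nat.lt_succ_iff.1 (Finset.mem_range.1 hi)
      rw [Nat.add_sub_assoc hi, Nat.add_sub_assoc hi, hwindow _ (by omega), sub_self]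
  · exact fun h => absurd (Finset.mem_range.2 (by omega)) h

end EventuallyPeriodic

/-! ### Periodicity of the kneading sequence -/

section KneadingSequence

section LinearOrder

variable {X : Type*} [LinearOrder X] {f : X → X} {c : X} {ω : ℤˣ}

theorem iterSign_succ_right (n : ℕ) (g : Germ X) :
    iterSign f c ω (n + 1) g = iterSign f c ω n g * lapSign c ω ((germMap f c ω)^[n] g) := by
  rw [iterSign_add, iterSign_one]

theorem eventuallyPeriodic_iterSign_of_mem_periodicPts (hc : c ∈ Function.periodicPts f)
    (σ : ℤˣ) : EventuallyPeriodic fun n => iterSign f c ω n (c, σ) := by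
  obtain ⟨p, hp, hpc⟩ := hc
  suffices h : EventuallyPeriodic fun n => (germMap f c ω)^[n] (c, σ) from h.map fun g => σ * g.2
  have hfin : (((fun n => f^[n] c) '' Set.Iio p) ×ˢ (Set.univ : Set ℤˣ)).Finite :=
    ((Set.finite_Iio p).image _).prod Set.finite_univ
  refine .of_finite_range (hfin.subset ?_) 0 fun m _ n _ heq => ?_
  · rintro _ ⟨n, rfl⟩
    refine ⟨⟨n % p, n.mod_lt hp, ?_⟩, Set.mem_univ _⟩
    rw [germMap_iterate_fst]
    exact hpc.iterate_mod_apply n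
  · rw [Function.iterate_succ_apply', Function.iterate_succ_apply', heq]

variable [TopologicalSpace X]

theorem IsTurning.dirLT_iterate_of_lapSign_eq (hf : IsTurning f c ω) {g g' : Germ X} {n : ℕ}
    (hlap : ∀ j < n,
      lapSign c ω ((germMap f c ω)^[j] g) = lapSign c ω ((germMap f c ω)^[j] g'))
    {τ : ℤˣ} (h : DirLT τ g.1 g'.1) :
    DirLT (τ * iterSign f c ω n g) (f^[n] g.1) (f^[n] g'.1) := by
  induction n with
  | zero => rwa [iterSign_zero, mul_one]
  | succ n ih =>
    have hmem := mem_lap_lapSign (c := c) (ω := ω) ((germMap f c ω)^[n] g)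
    have hmem' := mem_lap_lapSign (c := c) (ω := ω) ((germMap f c ω)^[n] g')
    rw [← hlap n n.lt_succ_self] at hmem'
    rw [germMap_iterate_fst] at hmem hmem'
    rw [iterSign_succ_right, ← mul_assoc, Function.iterate_succ_apply',
      Function.iterate_succ_apply']
    exact hf.dirLT_of_mem_lap hmem hmem' (ih fun j hj => hlap j (hj.trans n.lt_succ_self))

variable [OrderTopology X]

theorem eventually_lapSign_eq {x : X} (hx : x ≠ c) (τ : ℤˣ) :
    ∀ᶠ y in 𝓝 x, ∀ σ, lapSign c ω (y, σ) = lapSign c ω (x, τ) := by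
  rcases lt_or_gt_of_ne hx with hlt | hgt
  · filter_upwards [eventually_lt_nhds hlt] with y hy σ
    rw [lapSign_of_lt hy, lapSign_of_lt hlt]
  · filter_upwards [eventually_gt_nhds hgt] with y hy σ
    rw [lapSign_of_gt hy, lapSign_of_gt hgt]

theorem eventuallyPeriodic_iterSign_of_isAsymptotic (hf : Continuous f)
    (h : IsAsymptoticToPeriodicOrbit f c) (σ : ℤˣ) :
    EventuallyPeriodic fun n => iterSign f c ω n (c, σ) := by
  by_cases hc : c ∈ Function.periodicPts f
  · exact eventuallyPeriodic_iterSign_of_mem_periodicPts hc σ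
  obtain ⟨x, hx, m, hlim⟩ := h
  have hne : ∀ r, f^[r] x ≠ c := by
    rintro r rfl
    obtain ⟨q, hq, hqx⟩ := hx
    exact hc ⟨q, hq, hqx.apply_iterate r⟩
  suffices h : EventuallyPeriodic fun n => lapSign c ω ((germMap f c ω)^[n] (c, σ)) from
    .of_succ_eq_mul (fun n => iterSign_succ_right n _) h
  rw [← EventuallyPeriodic.comp_add_iff m]
  refine .of_residues (Function.minimalPeriod_pos_of_mem_periodicPts hx) fun r _ =>
    ⟨lapSign c ω (f^[r] x, 1), ?_⟩
  have hlim' := ((hf.iterate r).tendsto x).comp hlim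
  filter_upwards [hlim'.eventually (eventually_lapSign_eq (hne r) 1)] with k hk
  rw [Function.comp_apply, ← Function.iterate_add_apply, add_comm, add_right_comm] at hk
  rw [germMap_iterate_eq, hk]

end LinearOrder

theorem isAsymptoticToPeriodicOrbit_of_tendsto_iterate {X : Type*} [TopologicalSpace X] [T2Space X]
    {f : X → X} (hf : Continuous f) {x y : X} {n m : ℕ} (hn : 0 < n)
    (hlim : Tendsto (fun k => (f^[n])^[k] (f^[m] y)) atTop (𝓝 x)) :
    IsAsymptoticToPeriodicOrbit f y := by
  have hfix : Function.IsPeriodicPt f n x :=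
    isFixedPt_of_tendsto_iterate hlim (hf.iterate n).continuousAt
  refine ⟨x, ⟨n, hn, hfix⟩, m, ?_⟩
  set p := Function.minimalPeriod f x
  obtain ⟨q, rfl⟩ : p ∣ n := hfix.minimalPeriod_dvd
  intro s hs
  refine eventually_atTop_of_forall_residue (pos_of_mul_pos_right hn p.zero_le) fun r _ => ?_
  have hr : f^[p * r] x = x := (Function.isPeriodicPt_minimalPeriod f x).mul_const r
  have hlim' := ((hf.iterate (p * r)).tendsto x).comp hlim
  rw [hr] at hlim'
  filter_upwards [hlim' hs] with k hk
  rw [Set.mem_preimage, Function.comp_apply, ← Function.iterate_mul, ← Function.iterate_add_apply,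
    ← Function.iterate_add_apply] at hk
  rwa [show (k * q + r) * p + m = p * r + p * q * k + m by ring]

variable {X : Type*} [ConditionallyCompleteLinearOrder X] [TopologicalSpace X] [OrderTopology X]
  [BoundedOrder X] {f φ : X → X} {c : X} {ω : ℤˣ}

theorem exists_tendsto_iterate_of_dirLT {z : X}
    (h : ∀ τ k, DirLT τ (φ^[k] z) (φ^[k + 1] z) → DirLT τ (φ^[k + 1] z) (φ^[k + 2] z)) :
    ∃ x, Tendsto (fun k => φ^[k] z) atTop (𝓝 x) := by
  have hall : ∀ τ, DirLT τ z (φ z) → ∀ k, DirLT τ (φ^[k] z) (φ^[k + 1] z) := fun τ h₀ k => by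
    induction k with
    | zero => exact h₀
    | succ k ih => exact h τ k ih
  rcases lt_trichotomy z (φ z) with hlt | heq | hgt
  · exact ⟨_, tendsto_atTop_ciSup
      (monotone_nat_of_le_succ fun k => (dirLT_one.1 (hall 1 (dirLT_one.2 hlt) k)).le)
      (OrderTop.bddAbove _)⟩
  · exact ⟨z, tendsto_const_nhds.congr fun k => (Function.iterate_fixed heq.symm k).symm⟩
  · exact ⟨_, tendsto_atTop_ciInf (antitone_nat_of_succ_le fun k =>
      (dirLT_neg_one.1 (hall (-1) (dirLT_neg_one.2 hgt) k)).le) (OrderBot.bddBelow _)⟩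

theorem IsTurning.isAsymptotic_of_eventuallyPeriodic (hf : IsTurning f c ω) {σ : ℤˣ}
    (h : EventuallyPeriodic fun n => iterSign f c ω n (c, σ)) :
    IsAsymptoticToPeriodicOrbit f c := by
  obtain ⟨p, hp, hper⟩ := h
  obtain ⟨n₀, hn₀⟩ := eventually_atTop.1 hper
  beta_reduce at hn₀
  have hlap : ∀ n ≥ n₀, lapSign c ω ((germMap f c ω)^[n] (c, σ)) =
      lapSign c ω ((germMap f c ω)^[n + p] (c, σ)) := fun n hn => by
    have hsucc := hn₀ (n + 1) (by omega)
    rw [add_right_comm, iterSign_succ_right, iterSign_succ_right, hn₀ n hn] at hsucc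
    exact (mul_left_cancel hsucc).symm
  have hsign : ∀ n ≥ n₀, iterSign f c ω p ((germMap f c ω)^[n] (c, σ)) = 1 := fun n hn => by
    simpa only [iterSign_add, mul_eq_left] using hn₀ n hn
  have hstep : ∀ τ, ∀ n ≥ n₀, DirLT τ (f^[n] c) (f^[n + p] c) →
      DirLT τ (f^[n + p] c) (f^[n + p + p] c) := fun τ n hn hlt => by
    have := hf.dirLT_iterate_of_lapSign_eq (g := (germMap f c ω)^[n] (c, σ))
      (g' := (germMap f c ω)^[n + p] (c, σ)) (n := p) (τ := τ)
      (fun j _ => by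
        simp only [← Function.iterate_add_apply, ← add_assoc]
        exact hlap (j + n) (by omega))
      (by rwa [germMap_iterate_fst, germMap_iterate_fst])
    rwa [hsign n hn, mul_one, germMap_iterate_fst, germMap_iterate_fst,
      ← Function.iterate_add_apply, ← Function.iterate_add_apply, add_comm p, add_comm p] at this
  have hiter : ∀ k, (f^[p])^[k] (f^[n₀] c) = f^[n₀ + k * p] c := fun k => by
    rw [← Function.iterate_mul, ← Function.iterate_add_apply, mul_comm, add_comm]
  obtain ⟨x, hx⟩ := exists_tendsto_iterate_of_dirLT (φ := f^[p]) (z := f^[n₀] c) fun τ k hlt => by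
    have := hstep τ (n₀ + k * p) (by omega)
    simp only [hiter, add_mul, one_mul, two_mul, ← add_assoc] at this hlt ⊢
    exact this hlt
  exact isAsymptoticToPeriodicOrbit_of_tendsto_iterate hf.continuous hp hx

theorem IsTurning.isRationalSeries_kneadingSeries_iff (hf : IsTurning f c ω) :
    IsRationalSeries (kneadingSeries f c ω) ↔ IsAsymptoticToPeriodicOrbit f c := by
  constructor
  · intro h
    have hfin : (Set.range fun n => ((iterSign f c ω (n + 1) (c, -1) : ℤ) : ℚ)).Finite :=
      (Set.finite_range fun u : ℤˣ => ((u : ℤ) : ℚ)).subset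
        (Set.range_subset_iff.2 fun n => Set.mem_range_self (iterSign f c ω (n + 1) (c, -1)))
    obtain ⟨p, hp, hper⟩ := h.eventuallyPeriodic hfin
    refine hf.isAsymptotic_of_eventuallyPeriodic (σ := -1)
      ((EventuallyPeriodic.comp_add_iff 1).1 ⟨p, hp, hper.mono fun n hn => ?_⟩)
    exact Units.val_injective (Int.cast_injective hn)
  · intro h
    have hper := eventuallyPeriodic_iterSign_of_isAsymptotic (ω := ω) hf.continuous h (-1)
    exact (((EventuallyPeriodic.comp_add_iff 1).2 hper).map
      fun u : ℤˣ => ((u : ℤ) : ℚ)).isRationalSeries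

end KneadingSequence

theorem IsUnimodal.exists_isTurning {a b : ℝ} {f : Set.Icc a b → Set.Icc a b} {c : Set.Icc a b}
    (hf : IsUnimodal f c) : ∃ ω, IsTurning f c ω := by
  rcases hf.monotone_pieces with ⟨hleft, hright⟩ | ⟨hleft, hright⟩
  · exact ⟨1, hf.continuous,
      fun x y hxy hy => dirLT_one.2 (hleft (hxy.le.trans hy) hy hxy),
      fun x y hx hxy => dirLT_neg_one.2 (hright hx (hx.trans hxy.le) hxy)⟩
  · exact ⟨-1, hf.continuous,
      fun x y hxy hy => dirLT_neg_one.2 (hleft (hxy.le.trans hy) hy hxy),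
      fun x y hx hxy => dirLT_neg.2 (dirLT_neg_one.2 (hright hx (hx.trans hxy.le) hxy))⟩

end IntervalZeta

open IntervalZeta in
theorem mainTheorem3_general {X : Type*} [ConditionallyCompleteLinearOrder X] [BoundedOrder X]
    [DenselyOrdered X] [TopologicalSpace X] [OrderTopology X] {f : X → X} {c : X} {ω : ℤˣ}
    (hf : IsTurning f c ω) (hrep : {x ∈ Function.periodicPts f | ¬ IsRepelling f x}.Finite) :
    (∀ n : ℕ, 1 ≤ n → (Function.fixedPoints f^[n]).Finite) ∧
      (IsRationalSeries (artinMazurZeta f) ↔ IsAsymptoticToPeriodicOrbit f c) :=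
  ⟨fun _ hn => hf.finite_fixedPoints hrep hn,
    (hf.isRationalSeries_artinMazurZeta_iff hrep).trans hf.isRationalSeries_kneadingSeries_iff⟩

theorem mainTheorem3 {a b : ℝ} (f : Set.Icc a b → Set.Icc a b) (c : Set.Icc a b)
    (hf : IntervalZeta.IsUnimodal f c)
    (hrep : {x ∈ Function.periodicPts f | ¬ IntervalZeta.IsRepelling f x}.Finite) :
    (∀ n : ℕ, 1 ≤ n → (Function.fixedPoints f^[n]).Finite) ∧
      (IntervalZeta.IsRationalSeries (IntervalZeta.artinMazurZeta f) ↔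
        IntervalZeta.IsAsymptoticToPeriodicOrbit f c) := by
  have : Fact (a ≤ b) := ⟨hf.left_lt.le.trans hf.lt_right.le⟩
  let _ : Inhabited (Set.Icc a b) := ⟨c⟩
  obtain ⟨ω, hω⟩ := hf.exists_isTurning
  exact mainTheorem3_general hω hrep
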